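/- Let $r\ge 0$ be an integer and let $\mathrm{Par}$ be the set of all partitions (including the empty one); write $\ell(\lambda)$ for the number of (nonzero) parts of $\lambda$ and $\mathrm{rev}(\lambda)$ for its parts listed in weakly increasing order. Let $\Lambda(X)$ be the ring of symmetric functions over $\mathbb{Q}$ in the variables $X=\{x_1,x_2,\ldots\}$, i.e. formal power series of bounded degree over $\mathbb{Q}$ that are invariant under all permutations of the variables, and let $$\Lambda(X_1|\cdots|X_r):=\Lambda(X_1)\otimes_{\mathbb{Q}}\cdots\otimes_{\mathbb{Q}}\Lambda(X_r),\qquad X_i=\{x_{i,1},x_{i,2},\ldots\},$$ be the ring of $r$ multi-symmetric functions. For $n\ge 0$ the key polynomials $\mathcal{K}_\alpha\in\mathbb{Q}[x_1,\ldots,x_n]$, $\alpha\in\mathbb{Z}_{\ge 0}^n$, are the unique family of polynomials such that $\mathcal{K}_\alpha=x^\alpha$ whenever $\alpha_1\ge\cdots\ge\alpha_n$, and, whenever $1\le i\le n-1$ and $\alpha_i>\alpha_{i+1}$, $$\mathcal{K}_{s_i(\alpha)}=\xi_i(\mathcal{K}_\alpha),\qquad \xi_i(f):=\frac{x_i f-x_{i+1}s_i(f)}{x_i-x_{i+1}},$$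 where $s_i$ exchanges the $i$-th and $(i+1)$-st entries, respectively variables. For $\lambda=(\lambda^{(1)}|\cdots|\lambda^{(r)})\in\mathrm{Par}^r$ and $n_i\ge\ell(\lambda^{(i)})$ put $$\mathcal{S}^{(n_1|\cdots|n_r)}_{\lambda}:=\mathcal{K}_{(0^{n_1-\ell(\lambda^{(1)})}*\mathrm{rev}(\lambda^{(1)}))*\cdots*(0^{n_r-\ell(\lambda^{(r)})}*\mathrm{rev}(\lambda^{(r)}))}(x_{1,1},\ldots,x_{1,n_1},\ldots,x_{r,1},\ldots,x_{r,n_r}),$$ where $*$ denotes concatenation, and let the multi-symmetric Schur function be $$\mathcal{S}_\lambda(X_1|\cdots|X_r):=\lim_{n_1,\ldots,n_r\to\infty}\mathcal{S}^{(n_1|\cdots|n_r)}_{\lambda},$$ the limit being that of formal power series (the coefficient of each monomial is eventually constant). Then the canonical map sending $f_1\otimes\cdots\otimes f_r$ to the formal power series $f_1(X_1)\cdots f_r(X_r)$ in the variables $x_{i,j}$ is injective on $\Lambda(X_1|\cdots|X_r)$; with $\Lambda(X_1|\cdots|X_r)$ identified with its image, all the limits $\mathcal{S}_\lambda$ exist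 and lie in $\Lambda(X_1|\cdots|X_r)$, and the family $(\mathcal{S}_\lambda)_{\lambda\in\mathrm{Par}^r}$ is a $\mathbb{Q}$-basis of $\Lambda(X_1|\cdots|X_r)$. -/

import Mathlib

open scoped TensorProduct

noncomputable section

namespace MultiSymm

open MvPolynomial

/-! ### Isobaric divided difference operators -/

/-- Interchange of the variables `X i` and `X j`. -/
def swapVars {σ : Type*} [DecidableEq σ] (i j : σ) : MvPolynomial σ ℚ →ₐ[ℚ] MvPolynomial σ ℚ :=
  rename (Equiv.swap i j)

theorem sub_dvd_isobaric {σ : Type*} [DecidableEq σ] (i j : σ) (f : MvPolynomial σ ℚ) :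
    (X i - X j : MvPolynomial σ ℚ) ∣ X i * f - X j * swapVars i j f := by
  have key : ∀ f : MvPolynomial σ ℚ, (X i - X j : MvPolynomial σ ℚ) ∣ f - swapVars i j f := by
    intro f
    have h : (Ideal.Quotient.mkₐ ℚ (Ideal.span {(X i - X j : MvPolynomial σ ℚ)})).comp
        (swapVars i j) = Ideal.Quotient.mkₐ ℚ (Ideal.span {(X i - X j : MvPolynomial σ ℚ)}) := by
      apply MvPolynomial.algHom_ext
      intro k
      have hij : Ideal.Quotient.mk (Ideal.span {(X i - X j : MvPolynomial σ ℚ)}) (X i) =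
          Ideal.Quotient.mk _ (X j) :=
        Ideal.Quotient.eq.2 (Ideal.mem_span_singleton_self _)
      simp only [AlgHom.comp_apply, swapVars, rename_X, Ideal.Quotient.mkₐ_eq_mk]
      by_cases hi : k = i
      · subst hi; simp [hij]
      · by_cases hj : k = j
        · subst hj; simp [hij]
        · rw [Equiv.swap_apply_of_ne_of_ne hi hj]
    have h2 := DFunLike.congr_fun h f
    rw [← Ideal.mem_span_singleton]
    exact Ideal.Quotient.eq.1 h2.symm
  have : X i * f - X j * swapVars i j f = (X i - X j) * f + X j * (f - swapVars i j f) := by ring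
  rw [this]
  exact dvd_add (dvd_mul_right _ _) ((key f).mul_left _)

/-- The isobaric divided difference `(x_i f - x_j s_{ij} f) / (x_i - x_j)` for `i ≠ j`
(the exact quotient of polynomials). -/
def isobaric {σ : Type*} [DecidableEq σ] (i j : σ) (f : MvPolynomial σ ℚ) : MvPolynomial σ ℚ :=
  (sub_dvd_isobaric i j f).choose

theorem isobaric_spec {σ : Type*} [DecidableEq σ] (i j : σ) (f : MvPolynomial σ ℚ) :
    (X i - X j) * isobaric i j f = X i * f - X j * swapVars i j f :=
  (sub_dvd_isobaric i j f).choose_spec.symm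

/-! ### Key polynomials -/

/-- The two defining properties of the family of key polynomials in `n` variables. -/
structure IsKeyFamily {n : ℕ} (K : (Fin n → ℕ) → MvPolynomial (Fin n) ℚ) : Prop where
  dominant : ∀ a : Fin n → ℕ, Antitone a → K a = ∏ k, X k ^ a k
  step : ∀ (a : Fin n → ℕ) (i j : Fin n), (j : ℕ) = i + 1 → a j < a i →
    K (a ∘ Equiv.swap i j) = isobaric i j (K a)

theorem weight_swap_lt {n : ℕ} (a : Fin n → ℕ) (i j : Fin n) (hij : (j : ℕ) = i + 1)
    (h : a i < a j) :
    ∑ k : Fin n, (k : ℕ) * (a ∘ Equiv.swap i j) k < ∑ k : Fin n, (k : ℕ) * a k := by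
  have hne : j ≠ i := by intro h; rw [h] at hij; omega
  have split : ∀ b : Fin n → ℕ, ∑ k : Fin n, (k : ℕ) * b k =
      (i : ℕ) * b i + ((j : ℕ) * b j + ∑ k ∈ (Finset.univ.erase i).erase j, (k : ℕ) * b k) := by
    intro b
    rw [Finset.add_sum_erase _ (fun k : Fin n => (k : ℕ) * b k) (by simp [hne]),
      Finset.add_sum_erase _ (fun k : Fin n => (k : ℕ) * b k) (by simp)]
  rw [split, split a]
  have : ∑ k ∈ (Finset.univ.erase i).erase j, (k : ℕ) * (a ∘ Equiv.swap i j) k =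
      ∑ k ∈ (Finset.univ.erase i).erase j, (k : ℕ) * a k := by
    apply Finset.sum_congr rfl
    intro k hk
    simp only [Finset.mem_erase, Finset.mem_univ, and_true] at hk
    simp [Equiv.swap_apply_of_ne_of_ne hk.2 hk.1]
  rw [this]
  simp only [Function.comp, Equiv.swap_apply_left, Equiv.swap_apply_right, hij]
  nlinarith

open Classical in
/-- The key polynomial of `a`: the monomial `x^a` if `a` is weakly decreasing, and otherwise
`ξ_i (K_{s_i a})` for a position `i` with `a_i < a_{i+1}`. By `existsUnique_isKeyFamily` below
the choice of the position is immaterial. -/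
def keyPoly {n : ℕ} (a : Fin n → ℕ) : MvPolynomial (Fin n) ℚ :=
  if h : ∃ p : Fin n × Fin n, (p.2 : ℕ) = p.1 + 1 ∧ a p.1 < a p.2 then
    isobaric h.choose.1 h.choose.2 (keyPoly (a ∘ Equiv.swap h.choose.1 h.choose.2))
  else ∏ k, X k ^ a k
termination_by ∑ k : Fin n, (k : ℕ) * a k
decreasing_by exact weight_swap_lt a _ _ h.choose_spec.1 h.choose_spec.2

theorem isobaric_comm {σ : Type*} [DecidableEq σ] {i j k l : σ} (hij : i ≠ j) (hkl : k ≠ l)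
    (hik : i ≠ k) (hil : i ≠ l) (hjk : j ≠ k) (hjl : j ≠ l) (f : MvPolynomial σ ℚ) :
    isobaric i j (isobaric k l f) = isobaric k l (isobaric i j f) := by
  have e1 := isobaric_spec k l f
  have e2 := isobaric_spec i j (isobaric k l f)
  have e3 := congrArg (swapVars i j) e1
  have d1 := isobaric_spec i j f
  have d2 := isobaric_spec k l (isobaric i j f)
  have d3 := congrArg (swapVars k l) d1
  have hst : swapVars k l (swapVars i j f) = swapVars i j (swapVars k l f) := by
    simp only [swapVars, rename_rename]
    congr 2
    funext m
    simp only [Function.comp, Equiv.swap_apply_def]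
    grind
  simp only [map_mul, map_sub, hst] at e3 d3
  simp only [swapVars, rename_X] at e3 d3
  rw [Equiv.swap_apply_of_ne_of_ne hik.symm hjk.symm,
    Equiv.swap_apply_of_ne_of_ne hil.symm hjl.symm] at e3
  rw [Equiv.swap_apply_of_ne_of_ne hik hil, Equiv.swap_apply_of_ne_of_ne hjk hjl] at d3
  simp only [swapVars] at e1 e2 d1 d2
  have h1 : (X i - X j : MvPolynomial σ ℚ) ≠ 0 := sub_ne_zero.2 fun h => hij (X_injective h)
  have h2 : (X k - X l : MvPolynomial σ ℚ) ≠ 0 := sub_ne_zero.2 fun h => hkl (X_injective h)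
  apply mul_left_cancel₀ (mul_ne_zero h1 h2)
  linear_combination (X k - X l) * e2 + X i * e1 - X j * e3 - (X i - X j) * d2 - X k * d1 + X l * d3

theorem swapVars_isobaric {σ : Type*} [DecidableEq σ] {i j : σ} (hij : i ≠ j)
    (f : MvPolynomial σ ℚ) : swapVars i j (isobaric i j f) = isobaric i j f := by
  have e1 := isobaric_spec i j f
  have e2 := congrArg (swapVars i j) e1
  have hss : swapVars i j (swapVars i j f) = f := by
    have hc : (Equiv.swap i j : σ → σ) ∘ Equiv.swap i j = id := by
      funext m
      simp
    rw [swapVars, rename_rename, hc, rename_id_apply]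
  simp only [map_mul, map_sub, hss] at e2
  simp only [swapVars, rename_X, Equiv.swap_apply_left, Equiv.swap_apply_right] at e1 e2 ⊢
  have h1 : (X i - X j : MvPolynomial σ ℚ) ≠ 0 := sub_ne_zero.2 fun h => hij (X_injective h)
  apply mul_left_cancel₀ h1
  linear_combination -e2 - e1

theorem isobaric_braid {σ : Type*} [DecidableEq σ] {i j k : σ} (hij : i ≠ j) (hjk : j ≠ k)
    (hik : i ≠ k) (f : MvPolynomial σ ℚ) :
    isobaric i j (isobaric j k (isobaric i j f)) = isobaric j k (isobaric i j (isobaric j k f)) := by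
  have hb : swapVars j k (swapVars i j (swapVars j k f)) =
      swapVars i j (swapVars j k (swapVars i j f)) := by
    simp only [swapVars, rename_rename]
    congr 2
    funext m
    simp only [Function.comp, Equiv.swap_apply_def]
    grind
  have h1 : (X i - X j : MvPolynomial σ ℚ) ≠ 0 := sub_ne_zero.2 fun h => hij (X_injective h)
  have h2 : (X j - X k : MvPolynomial σ ℚ) ≠ 0 := sub_ne_zero.2 fun h => hjk (X_injective h)
  have h3 : (X i - X k : MvPolynomial σ ℚ) ≠ 0 := sub_ne_zero.2 fun h => hik (X_injective h)
  have si : swapVars i j (X i) = X j := by simp [swapVars]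
  have sj : swapVars i j (X j) = X i := by simp [swapVars]
  have sk : swapVars i j (X k) = X k := by
    simp [swapVars, Equiv.swap_apply_of_ne_of_ne hik.symm hjk.symm]
  have ti : swapVars j k (X i) = X i := by
    simp [swapVars, Equiv.swap_apply_of_ne_of_ne hij hik]
  have tj : swapVars j k (X j) = X k := by simp [swapVars]
  have tk : swapVars j k (X k) = X j := by simp [swapVars]
  have a1 := isobaric_spec i j f
  have a2 := isobaric_spec j k (isobaric i j f)
  have a3 := isobaric_spec i j (isobaric j k (isobaric i j f))
  have a4 := congrArg (swapVars j k) a1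
  have a5 := congrArg (swapVars i j) a2
  have a6 := congrArg (swapVars i j) a4
  have b1 := isobaric_spec j k f
  have b2 := isobaric_spec i j (isobaric j k f)
  have b3 := isobaric_spec j k (isobaric i j (isobaric j k f))
  have b4 := congrArg (swapVars i j) b1
  have b5 := congrArg (swapVars j k) b2
  have b6 := congrArg (swapVars j k) b4
  simp only [map_mul, map_sub, si, sj, sk, ti, tj, tk, swapVars_isobaric hij,
    swapVars_isobaric hjk, hb] at a4 a5 a6 b4 b5 b6
  apply mul_left_cancel₀ (mul_ne_zero (mul_ne_zero h1 h2) h3)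
  linear_combination (X j - X k) * (X i - X k) * a3 + X i * (X i - X k) * a2 -
    X j * (X j - X k) * a5 + X i * X j * a1 - X i * X k * a4 + X j * X k * a6 -
    ((X i - X j) * (X i - X k) * b3 + X j * (X i - X k) * b2 -
    X k * (X i - X j) * b5 + X i * X i * b1 - X j * X j * b4 + X k * X k * b6)

theorem keyPoly_of_ascent {n : ℕ} (N : ℕ) : ∀ a : Fin n → ℕ, ∑ k : Fin n, (k : ℕ) * a k = N →
    ∀ i j : Fin n, (j : ℕ) = i + 1 → a i < a j →
      keyPoly a = isobaric i j (keyPoly (a ∘ Equiv.swap i j)) := by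
  induction N using Nat.strong_induction_on with
  | _ N ih =>
    intro a ha
    -- the case of two adjacent ascents
    have braid : ∀ x y z : Fin n, (y : ℕ) = x + 1 → (z : ℕ) = y + 1 → a x < a y → a y < a z →
        isobaric x y (keyPoly (a ∘ Equiv.swap x y)) =
          isobaric y z (keyPoly (a ∘ Equiv.swap y z)) := by
      intro x y z hxy hyz h1 h2
      have nxy : x ≠ y := by rintro rfl; omega
      have nyz : y ≠ z := by rintro rfl; omega
      have nxz : x ≠ z := by rintro rfl; omega
      have sz : Equiv.swap x y z = z := Equiv.swap_apply_of_ne_of_ne nxz.symm nyz.symm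
      have tx : Equiv.swap y z x = x := Equiv.swap_apply_of_ne_of_ne nxy nxz
      have w1 := weight_swap_lt a x y hxy h1
      have w2 := weight_swap_lt a y z hyz h2
      have g1 : (a ∘ Equiv.swap x y) y < (a ∘ Equiv.swap x y) z := by
        simp [sz]; omega
      have g2 : (a ∘ Equiv.swap y z) x < (a ∘ Equiv.swap y z) y := by
        simp [tx]; omega
      have w3 := weight_swap_lt _ y z hyz g1
      have w4 := weight_swap_lt _ x y hxy g2
      rw [ih _ (ha ▸ w1) (a ∘ Equiv.swap x y) rfl y z hyz g1,
        ih _ (ha ▸ w2) (a ∘ Equiv.swap y z) rfl x y hxy g2,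
        ih _ (ha ▸ (w3.trans w1)) ((a ∘ Equiv.swap x y) ∘ Equiv.swap y z) rfl x y hxy (by
          simpa [sz, tx] using h2),
        ih _ (ha ▸ (w4.trans w2)) ((a ∘ Equiv.swap y z) ∘ Equiv.swap x y) rfl y z hyz (by
          simpa [sz, tx] using h1),
        isobaric_braid nxy nyz nxz]
      congr 4
      funext m
      simp only [Function.comp, Equiv.swap_apply_def]
      grind
    intro i j hij hlt
    have h : ∃ p : Fin n × Fin n, (p.2 : ℕ) = p.1 + 1 ∧ a p.1 < a p.2 := ⟨(i, j), hij, hlt⟩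
    rw [keyPoly, dif_pos h]
    obtain ⟨hpq, hp⟩ := h.choose_spec
    generalize h.choose.1 = p at hpq hp ⊢
    generalize h.choose.2 = q at hpq hp ⊢
    by_cases e1 : p = i
    · subst e1
      have : q = j := Fin.ext (by omega)
      rw [this]
    have e1' : (p : ℕ) ≠ i := fun h => e1 (Fin.ext h)
    by_cases e2 : q = i
    · subst e2
      exact braid p q j hpq hij hp hlt
    by_cases e3 : j = p
    · subst e3
      exact (braid i j q hij hpq hlt hp).symm
    have e2' : (q : ℕ) ≠ i := fun h => e2 (Fin.ext h)
    have e3' : (j : ℕ) ≠ p := fun h => e3 (Fin.ext h)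
    have n1 : p ≠ q := by rintro rfl; omega
    have n2 : i ≠ j := by rintro rfl; omega
    have n3 : q ≠ j := by rintro rfl; omega
    rw [ih _ (ha ▸ weight_swap_lt a p q hpq hp) (a ∘ Equiv.swap p q) rfl i j hij (by
        simpa [Equiv.swap_apply_of_ne_of_ne (Ne.symm e1) (Ne.symm e2),
          Equiv.swap_apply_of_ne_of_ne e3 (Ne.symm n3)] using hlt),
      ih _ (ha ▸ weight_swap_lt a i j hij hlt) (a ∘ Equiv.swap i j) rfl p q hpq (by
        simpa [Equiv.swap_apply_of_ne_of_ne e1 (Ne.symm e3),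
          Equiv.swap_apply_of_ne_of_ne e2 n3] using hp),
      isobaric_comm n1 n2 e1 (Ne.symm e3) e2 n3]
    congr 3
    funext m
    simp only [Function.comp, Equiv.swap_apply_def]
    grind

theorem isKeyFamily_keyPoly (n : ℕ) : IsKeyFamily (keyPoly : (Fin n → ℕ) → _) where
  dominant a ha := by
    rw [keyPoly, dif_neg]
    rintro ⟨⟨p, q⟩, h1, h2⟩
    exact absurd (ha (show p ≤ q from Fin.le_def.2 (by simp only at h1; omega))) (not_le.2 h2)
  step a i j hij h := by
    rw [keyPoly_of_ascent _ (a ∘ Equiv.swap i j) rfl i j hij (by simpa using h)]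
    congr 2
    funext m
    simp

/-- The family `keyPoly` is the only one with the two defining properties of key polynomials. -/
theorem existsUnique_isKeyFamily (n : ℕ) :
    ∃! K : (Fin n → ℕ) → MvPolynomial (Fin n) ℚ, IsKeyFamily K := by
  refine ⟨keyPoly, isKeyFamily_keyPoly n, fun K hK => ?_⟩
  suffices H : ∀ N, ∀ a : Fin n → ℕ, ∑ k : Fin n, (k : ℕ) * a k = N → K a = keyPoly a from
    funext fun a => H _ a rfl
  intro N
  induction N using Nat.strong_induction_on with
  | _ N ih =>
    intro a ha
    by_cases h : ∃ i j : Fin n, (j : ℕ) = i + 1 ∧ a i < a j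
    · obtain ⟨i, j, hij, hlt⟩ := h
      have hk : a = (a ∘ Equiv.swap i j) ∘ Equiv.swap i j := by
        funext m
        simp
      rw [keyPoly_of_ascent _ a rfl i j hij hlt, ← ih _ (ha ▸ weight_swap_lt a i j hij hlt) _ rfl,
        ← hK.step _ i j hij (by simpa using hlt), ← hk]
    · push Not at h
      have hanti : Antitone a := by
        cases n with
        | zero => exact fun x => x.elim0
        | succ n => exact Fin.antitone_iff_succ_le.2 fun i => h i.castSucc i.succ (by simp)
      rw [hK.dominant a hanti, (isKeyFamily_keyPoly n).dominant a hanti]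

/-! ### Symmetric and multi-symmetric functions -/

/-- The ring `Λ(X)` of symmetric functions over `ℚ`: formal power series of bounded degree in
countably many variables that are invariant under all permutations of the variables. -/
def SymmFun : Subalgebra ℚ (MvPowerSeries ℕ ℚ) where
  carrier := {f | (∃ N : ℕ, ∀ d : ℕ →₀ ℕ, MvPowerSeries.coeff d f ≠ 0 → d.degree ≤ N) ∧
    ∀ s : Equiv.Perm ℕ, MvPowerSeries.rename s f = f}
  mul_mem' := by
    classical
    rintro f g ⟨⟨M, hM⟩, hf⟩ ⟨⟨N, hN⟩, hg⟩
    refine ⟨⟨M + N, fun d hd => ?_⟩, fun s => by rw [map_mul, hf, hg]⟩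
    rw [MvPowerSeries.coeff_mul] at hd
    obtain ⟨p, hp, hne⟩ := Finset.exists_ne_zero_of_sum_ne_zero hd
    rw [← Finset.HasAntidiagonal.mem_antidiagonal.1 hp, map_add]
    exact add_le_add (hM _ (left_ne_zero_of_mul hne)) (hN _ (right_ne_zero_of_mul hne))
  add_mem' := by
    rintro f g ⟨⟨M, hM⟩, hf⟩ ⟨⟨N, hN⟩, hg⟩
    refine ⟨⟨max M N, fun d hd => ?_⟩, fun s => by rw [map_add, hf, hg]⟩
    by_cases h : MvPowerSeries.coeff d f = 0
    · exact le_max_of_le_right (hN d (by simpa [h] using hd))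
    · exact le_max_of_le_left (hM d h)
  algebraMap_mem' c := by
    classical
    refine ⟨⟨0, fun d hd => ?_⟩, fun s => AlgHom.commutes _ c⟩
    rw [MvPowerSeries.algebraMap_apply, MvPowerSeries.coeff_C] at hd
    by_cases h : d = 0
    · simp [h]
    · simp [h] at hd

/-- The ring `Λ(X_1|⋯|X_r) = Λ(X_1) ⊗ ⋯ ⊗ Λ(X_r)` of `r` multi-symmetric functions. -/
abbrev MultiSymmFun (r : ℕ) : Type := ⨂[ℚ] _ : Fin r, SymmFun

instance tendstoCofinite_mk {r : ℕ} (i : Fin r) :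
    Filter.TendstoCofinite (Prod.mk i : ℕ → Fin r × ℕ) :=
  Filter.tendstoCofinite_of_injective (Prod.mk_right_injective i)

/-- The expansion of a multi-symmetric function as a formal power series in the variables
`x_{i,j}`: it sends `f_1 ⊗ ⋯ ⊗ f_r` to `f_1(X_1) ⋯ f_r(X_r)`. The variable `x_{i,j}` has index
`(i, j)`, both coordinates being counted from zero. -/
def expand (r : ℕ) : MultiSymmFun r →ₗ[ℚ] MvPowerSeries (Fin r × ℕ) ℚ :=
  PiTensorProduct.lift
    ((MultilinearMap.mkPiAlgebra ℚ (Fin r) (MvPowerSeries (Fin r × ℕ) ℚ)).compLinearMap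
      fun i => ((MvPowerSeries.rename (Prod.mk i)).comp SymmFun.val).toLinearMap)

/-! ### Multi-symmetric Schur functions -/

/-- The composition `(0^{n_1 - ℓ(λ^1)} * rev λ^1) * ⋯ * (0^{n_r - ℓ(λ^r)} * rev λ^r)` of length
`n_1 + ⋯ + n_r`, for `n_i ≥ ℓ(λ^i)`. A partition is a Young diagram, with parts its row lengths,
so that the entry in position `j` of the `i`-th block is the part of `λ^i` with (zero-based) index
`n_i - 1 - j`, which is zero if that index is at least `ℓ(λ^i)`. -/
def blockComposition {r : ℕ} (lam : Fin r → YoungDiagram) (n : Fin r → ℕ) :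
    Fin (∑ i, n i) → ℕ := fun k =>
  (lam (finSigmaFinEquiv.symm k).1).rowLen (finSigmaFinEquiv.symm k).2.rev

/-- The multi-symmetric Schur polynomial, i.e. the key polynomial of the block composition in the
variables `x_{1,1}, …, x_{1,n_1}, …, x_{r,1}, …, x_{r,n_r}`. -/
def multiSchurPoly {r : ℕ} (lam : Fin r → YoungDiagram) (n : Fin r → ℕ) :
    MvPolynomial (Fin r × ℕ) ℚ :=
  rename (fun k => ((finSigmaFinEquiv.symm k).1, ((finSigmaFinEquiv.symm k).2 : ℕ)))
    (keyPoly (blockComposition lam n))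

/-- `f` is the multi-symmetric Schur function of `lam`: its expansion is the limit of the
multi-symmetric Schur polynomials as `n_1, …, n_r → ∞`, i.e. each coefficient of these polynomials
is eventually equal to that of `f`. -/
def IsMultiSchurFun {r : ℕ} (lam : Fin r → YoungDiagram) (f : MultiSymmFun r) : Prop :=
  ∀ d : Fin r × ℕ →₀ ℕ, ∀ᶠ n : Fin r → ℕ in Filter.atTop,
    (multiSchurPoly lam n).coeff d = MvPowerSeries.coeff d (expand r f)

end MultiSymm

end

/-! Three properties of a key polynomial `K_a` carry the theorem. (1) If `a_i ≤ a_{i+1}`, then `K_a`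
is symmetric in `x_i, x_{i+1}`. For a strict ascent it lies in the image of `ξ_i`; for equal entries
this follows from the commutation and braid relations (`isobaric_keyL_of_eq`, `keyL_swap_of_le`).
(2) Setting a variable with exponent zero to zero deletes it from the composition
(`coeff_zero_splitVar_keyL`). (3) `K_a` is homogeneous of degree `|a|` (`isHomogeneous_keyL`).

In a block composition every block is weakly increasing, with its zeros in front. By (1) each block
is symmetric in its variables. Together with (2), the coefficient of a monomial does not depend on
the variables used, once they contain those of the monomial and are numerous enough
(`coeff_multiKey_of_subset`). So the limit exists and is invariant under permutations within each
`X_i`. By (3) it is a finite combination of products of monomial symmetric functions. These products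
form a basis of the tensor product, and the coordinates in it are coefficients of the expansion
(`coeff_expand`), which also gives injectivity.

For independence, the leading coefficient of `K_a` in the last variable is the key polynomial of `a`
without its last entry, so key polynomials are linearly independent (`linearIndependent_keyPoly`).
Setting all but finitely many variables to zero turns finitely many `S_λ` into distinct key
polynomials. Spanning is a dimension count: the `S_λ` of a given degree are independent, and as
numerous as the monomial products of that degree (`span_range_eq_top_of_graded`). -/

open scoped TensorProduct

noncomputable section

namespace MultiSymm

open MvPolynomial

/-! ### Key polynomials of lists of variables with exponents -/

section ListKey

variable {σ τ : Type*}

/-- The key polynomial of a composition, in a given sequence of variables; the list consists of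
the pairs of a variable and the corresponding entry of the composition. -/
def keyL (l : List (σ × ℕ)) : MvPolynomial σ ℚ :=
  rename (fun k : Fin l.length => (l.get k).1) (keyPoly fun k : Fin l.length => (l.get k).2)

/-- The free length `n` avoids casts between `Fin` types of propositionally equal size. -/
theorem keyL_of_get {n : ℕ} (l : List (σ × ℕ)) (h : l.length = n) (v : Fin n → σ) (a : Fin n → ℕ)
    (hl : ∀ (k : ℕ) (hk : k < n), l[k] = (v ⟨k, hk⟩, a ⟨k, hk⟩)) :
    keyL l = rename v (keyPoly a) := by
  subst h
  unfold keyL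
  congr 1
  · congr 1
    funext k
    simp [hl]
  · congr 1
    funext k
    simp [hl]

theorem keyL_ofFn {n : ℕ} (v : Fin n → σ) (a : Fin n → ℕ) :
    keyL (List.ofFn fun k => (v k, a k)) = rename v (keyPoly a) :=
  keyL_of_get _ (by simp) v a (by simp)

theorem rename_keyL (f : σ → τ) (l : List (σ × ℕ)) :
    rename f (keyL l) = keyL (l.map fun x => (f x.1, x.2)) := by
  unfold keyL
  rw [rename_rename]
  exact (keyL_of_get _ (by simp) _ _ (by simp)).symm

theorem keyL_of_isChain (l : List (σ × ℕ)) (h : l.IsChain fun x y => y.2 ≤ x.2) :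
    keyL l = (l.map fun x => X x.1 ^ x.2).prod := by
  have hp : l.Pairwise fun x y => y.2 ≤ x.2 :=
    haveI : Trans (fun x y : σ × ℕ => y.2 ≤ x.2) (fun x y : σ × ℕ => y.2 ≤ x.2)
        (fun x y : σ × ℕ => y.2 ≤ x.2) :=
      ⟨fun h1 h2 => le_trans h2 h1⟩
    List.isChain_iff_pairwise.1 h
  have ha : Antitone fun k : Fin l.length => (l.get k).2 := by
    intro i j hij
    rcases hij.eq_or_lt with rfl | hlt
    · exact le_rfl
    · exact List.pairwise_iff_get.1 hp i j hlt
  unfold keyL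
  rw [(isKeyFamily_keyPoly _).dominant _ ha, map_prod]
  simp only [map_pow, rename_X]
  conv_rhs => rw [← List.ofFn_get l, List.map_ofFn, List.prod_ofFn]
  rfl

/-- The sum of the entries of a list, weighted by their positions. -/
def listWeight : List (σ × ℕ) → ℕ
  | [] => 0
  | _ :: l => (l.map Prod.snd).sum + listWeight l

theorem listWeight_lt (p q : List (σ × ℕ)) {u v : σ} {a b : ℕ} (hab : a < b) :
    listWeight (p ++ (u, b) :: (v, a) :: q) < listWeight (p ++ (u, a) :: (v, b) :: q) := by
  induction p with
  | nil => simp [listWeight]; omega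
  | cons x p ih => simp [listWeight] at ih ⊢; omega

/-- Every list can be reached from the weakly decreasing ones by exchanging the entries of two
adjacent positions `x > y`. -/
theorem list_swap_induction {P : List (σ × ℕ) → Prop}
    (sorted : ∀ l, l.IsChain (fun x y => y.2 ≤ x.2) → P l)
    (step : ∀ p q u v a b, a < b → P (p ++ (u, b) :: (v, a) :: q) →
      P (p ++ (u, a) :: (v, b) :: q)) (l : List (σ × ℕ)) : P l := by
  induction h : listWeight l using Nat.strong_induction_on generalizing l with
  | _ N ih =>
    by_cases hl : l.IsChain fun x y => y.2 ≤ x.2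
    · exact sorted l hl
    · rw [List.isChain_iff_forall_rel_of_append_cons_cons] at hl
      push Not at hl
      obtain ⟨⟨u, a⟩, ⟨v, b⟩, p, q, rfl, hab⟩ := hl
      exact step p q u v a b hab (ih _ (h ▸ listWeight_lt p q hab) _ rfl)

theorem X_sub_X_ne_zero {i j : σ} (h : i ≠ j) : (X i - X j : MvPolynomial σ ℚ) ≠ 0 :=
  sub_ne_zero.2 fun e => h (X_injective e)

variable [DecidableEq σ]

theorem isobaric_unique {i j : σ} (h : i ≠ j) {f g : MvPolynomial σ ℚ}
    (hg : (X i - X j) * g = X i * f - X j * swapVars i j f) : isobaric i j f = g :=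
  mul_left_cancel₀ (X_sub_X_ne_zero h) ((isobaric_spec i j f).trans hg.symm)

/-- Turns symmetry into an equation between operators, to which the commutation and braid relations
apply. -/
theorem isobaric_eq_self_iff {i j : σ} (h : i ≠ j) (f : MvPolynomial σ ℚ) :
    isobaric i j f = f ↔ swapVars i j f = f := by
  constructor
  · intro e
    rw [← e, swapVars_isobaric h]
  · intro e
    apply isobaric_unique h
    rw [e]
    ring

theorem rename_swapVars [DecidableEq τ] {f : σ → τ} (hf : Function.Injective f) (i j : σ)
    (p : MvPolynomial σ ℚ) :
    rename f (swapVars i j p) = swapVars (f i) (f j) (rename f p) := by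
  simp only [swapVars, rename_rename]
  congr 2
  funext k
  simp only [Function.comp, hf.swap_apply]

theorem rename_isobaric [DecidableEq τ] {f : σ → τ} (hf : Function.Injective f) {i j : σ}
    (h : i ≠ j) (p : MvPolynomial σ ℚ) :
    rename f (isobaric i j p) = isobaric (f i) (f j) (rename f p) := by
  refine (isobaric_unique (hf.ne h) ?_).symm
  rw [← rename_swapVars hf]
  simpa using congrArg (rename f) (isobaric_spec i j p)

/-- The recursion for key polynomials, in list form. Distinctness makes the map from positions to
variables injective, so that renaming commutes with the divided difference. -/
theorem keyL_of_lt (p q : List (σ × ℕ)) {u v : σ} {a b : ℕ} (hab : a < b)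
    (hn : ((p ++ (u, a) :: (v, b) :: q).map Prod.fst).Nodup) :
    keyL (p ++ (u, a) :: (v, b) :: q) = isobaric u v (keyL (p ++ (u, b) :: (v, a) :: q)) := by
  set l := p ++ (u, a) :: (v, b) :: q with hl
  have hlen : l.length = p.length + (q.length + 2) := by simp [hl]
  let i : Fin l.length := ⟨p.length, by omega⟩
  let j : Fin l.length := ⟨p.length + 1, by omega⟩
  have hi : l.get i = (u, a) := by simp [i, hl]
  have hj : l.get j = (v, b) := by simp [j, hl]
  have hij : i ≠ j := by simp [i, j]
  have hinj : Function.Injective fun k : Fin l.length => (l.get k).1 := by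
    intro x y hxy
    have := hn.injective_get (a₁ := x.cast (by simp)) (a₂ := y.cast (by simp)) (by simpa using hxy)
    exact Fin.ext (by simpa using congrArg Fin.val this)
  rw [keyL, keyPoly_of_ascent _ _ rfl i j rfl (by rw [hi, hj]; exact hab),
    rename_isobaric hinj hij]
  simp only [hi, hj]
  congr 1
  refine (keyL_of_get _ (by simp [hlen]) _ _ fun k hk => ?_).symm
  have hs : (⟨k, hk⟩ : Fin l.length) = i ∨ ⟨k, hk⟩ = j ∨ (⟨k, hk⟩ ≠ i ∧ (⟨k, hk⟩ : Fin l.length) ≠ j) := by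
    tauto
  rcases hs with e | e | ⟨e1, e2⟩
  · have : k = p.length := congrArg Fin.val e
    rw [e]
    simp only [Function.comp, Equiv.swap_apply_left, hi, hj]
    simp [this]
  · have : k = p.length + 1 := congrArg Fin.val e
    rw [e]
    simp only [Function.comp, Equiv.swap_apply_right, hi, hj]
    simp [this]
  · simp only [Function.comp, Equiv.swap_apply_of_ne_of_ne e1 e2]
    have e1 : k ≠ p.length := fun h => e1 (Fin.ext h)
    have e2 : k ≠ p.length + 1 := fun h => e2 (Fin.ext h)
    simp only [List.get_eq_getElem, hl, List.getElem_append, List.getElem_cons]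
    have e3 : ¬ (k - p.length - 1 = 0 ∧ ¬ k < p.length) := by omega
    grind

end ListKey

/-! ### Symmetry of key polynomials in adjacent positions -/

section ListKey

variable {σ : Type*}

/-- The position of a marked entry relative to two adjacent entries of a list. -/
theorem append_cons_eq_append_cons_cons {α : Type*} {p q p' q' : List α} {u x y : α}
    (h : p' ++ x :: y :: q' = p ++ u :: q) :
    (∃ t, p' = p ++ u :: t ∧ q = t ++ x :: y :: q') ∨ (p' = p ∧ x = u ∧ q = y :: q') ∨
      (p = p' ++ [x] ∧ y = u ∧ q' = q) ∨ ∃ t, p = p' ++ x :: y :: t ∧ q' = t ++ u :: q := by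
  rcases List.append_eq_append_iff.1 h with ⟨t, ht, ht'⟩ | ⟨t, ht, ht'⟩
  · match t, ht, ht' with
    | [], ht, ht' =>
      simp only [List.nil_append, List.cons.injEq] at ht'
      exact Or.inr (Or.inl ⟨by simp [ht], ht'.1, ht'.2.symm⟩)
    | [z], ht, ht' =>
      simp only [List.cons_append, List.nil_append, List.cons.injEq] at ht'
      exact Or.inr (Or.inr (Or.inl ⟨by simp [ht, ht'.1], ht'.2⟩))
    | z :: z' :: t, ht, ht' =>
      simp only [List.cons_append, List.cons.injEq] at ht'
      exact Or.inr (Or.inr (Or.inr ⟨t, by simp [ht, ht'.1, ht'.2.1], ht'.2.2⟩))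
  · match t, ht, ht' with
    | [], ht, ht' =>
      simp only [List.nil_append, List.cons.injEq] at ht'
      exact Or.inr (Or.inl ⟨by simp [ht], ht'.1.symm, ht'.2⟩)
    | z :: t, ht, ht' =>
      simp only [List.cons_append, List.cons.injEq] at ht'
      exact Or.inl ⟨t, by simp [ht, ht'.1], ht'.2⟩

theorem notMem_of_nodup_append_cons {p q : List (σ × ℕ)} {u : σ} {a : ℕ}
    (hn : ((p ++ (u, a) :: q).map Prod.fst).Nodup) :
    u ∉ p.map Prod.fst ∧ u ∉ q.map Prod.fst := by
  simp only [List.map_append, List.map_cons, List.nodup_append, List.nodup_cons] at hn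
  exact ⟨fun h => hn.2.2 u h u (by simp) rfl, hn.2.1.1⟩

theorem ne_of_nodup_append_cons_cons {p q : List (σ × ℕ)} {u v : σ} {a b : ℕ}
    (hn : ((p ++ (u, a) :: (v, b) :: q).map Prod.fst).Nodup) : u ≠ v := by
  rintro rfl
  simp [List.nodup_append] at hn

variable [DecidableEq σ]

theorem map_swap_eq_self {l : List (σ × ℕ)} {u v : σ} (hu : u ∉ l.map Prod.fst)
    (hv : v ∉ l.map Prod.fst) : (l.map fun x => (Equiv.swap u v x.1, x.2)) = l := by
  conv_rhs => rw [← List.map_id l]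
  apply List.map_congr_left
  intro x hx
  have hx' := List.mem_map_of_mem (f := Prod.fst) hx
  have h1 : x.1 ≠ u := fun e => hu (e ▸ hx')
  have h2 : x.1 ≠ v := fun e => hv (e ▸ hx')
  simp [Equiv.swap_apply_of_ne_of_ne h1 h2]

theorem swapVars_X_of_ne {i j k : σ} (hi : k ≠ i) (hj : k ≠ j) :
    swapVars i j (X k : MvPolynomial σ ℚ) = X k := by
  simp [swapVars, Equiv.swap_apply_of_ne_of_ne hi hj]

/-- Induction on the weight: a monomial with equal exponents is visibly symmetric, and otherwise
some ascent is undone. If the ascent is disjoint from the two equal entries, the operators commute;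
if it shares one of them, the braid relation moves the symmetry to a list of smaller weight. -/
theorem isobaric_keyL_of_eq (l : List (σ × ℕ)) (hn : (l.map Prod.fst).Nodup)
    (p q : List (σ × ℕ)) (u v : σ) (a : ℕ) (hl : l = p ++ (u, a) :: (v, a) :: q) :
    isobaric u v (keyL l) = keyL l := by
  induction h : listWeight l using Nat.strong_induction_on generalizing l p q u v a with
  | _ N ih =>
    have huv : u ≠ v := by
      rintro rfl
      simp [hl, List.nodup_append] at hn
    by_cases hc : l.IsChain fun x y => y.2 ≤ x.2
    · rw [isobaric_eq_self_iff huv, keyL_of_isChain l hc, hl]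
      have hfix : ∀ t : List (σ × ℕ), (∀ x ∈ t, x.1 ≠ u ∧ x.1 ≠ v) →
          swapVars u v (t.map fun x => (X x.1 ^ x.2 : MvPolynomial σ ℚ)).prod =
            (t.map fun x => X x.1 ^ x.2).prod := by
        intro t ht
        rw [map_list_prod, List.map_map]
        congr 1
        apply List.map_congr_left
        intro x hx
        simp [swapVars_X_of_ne (ht x hx).1 (ht x hx).2]
      have hp : ∀ x ∈ p, x.1 ≠ u ∧ x.1 ≠ v := by
        intro x hx
        simp only [hl, List.map_append, List.nodup_append, List.map_cons] at hn
        have := hn.2.2 x.1 (List.mem_map_of_mem hx)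
        exact ⟨this _ (by simp), this _ (by simp)⟩
      have hq : ∀ x ∈ q, x.1 ≠ u ∧ x.1 ≠ v := by
        intro x hx
        have hx' := List.mem_map_of_mem (f := Prod.fst) hx
        simp only [hl, List.map_append, List.nodup_append, List.map_cons, List.nodup_cons] at hn
        exact ⟨fun e => hn.2.1.1 (by simp [← e, hx']), fun e => hn.2.1.2.1 (by simp [← e, hx'])⟩
      simp only [List.map_append, List.prod_append, List.map_cons, List.prod_cons, map_mul,
        hfix p hp, hfix q hq, map_pow]
      simp only [swapVars, rename_X, Equiv.swap_apply_left, Equiv.swap_apply_right]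
      ring
    · rw [List.isChain_iff_forall_rel_of_append_cons_cons] at hc
      push Not at hc
      obtain ⟨⟨x, c⟩, ⟨y, d⟩, p', q', e, hcd⟩ := hc
      simp only at hcd
      have commuting : ∀ p₁ q₁, p' ++ (x, d) :: (y, c) :: q' = p₁ ++ (u, a) :: (v, a) :: q₁ →
          u ≠ x → u ≠ y → v ≠ x → v ≠ y → x ≠ y → isobaric u v (keyL l) = keyL l := by
        intro p₁ q₁ e₁ h1 h2 h3 h4 h5
        rw [e, keyL_of_lt p' q' hcd (e ▸ hn), isobaric_comm huv h5 h1 h2 h3 h4]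
        congr 1
        refine ih _ ?_ _ ?_ p₁ q₁ u v a e₁ rfl
        · rw [← h, e]
          exact listWeight_lt _ _ hcd
        · simpa [e] using hn
      have hw : listWeight (p' ++ (x, d) :: (y, c) :: q') < N := by
        rw [← h, e]
        exact listWeight_lt _ _ hcd
      rcases List.append_eq_append_iff.1 (hl.symm.trans e) with ⟨t, ht, ht'⟩ | ⟨t, ht, ht'⟩
      · match t, ht, ht' with
        | [], _, ht' => simp at ht'; omega
        -- Entries `a, a, d` with `a < d`: the polynomial is `ξ_{vy} ξ_{uv} g` with `g` of exponents
        -- `d, a, a`, fixed by `ξ_{vy}` by induction. Hence `ξ_{uv} ξ_{vy} ξ_{uv} g = ξ_{vy} ξ_{uv}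
        -- ξ_{vy} g = ξ_{vy} ξ_{uv} g`.
        | [z], ht, ht' =>
          simp at ht'
          obtain ⟨rfl, ⟨rfl, rfl⟩, rfl⟩ := ht'
          have e1 : l = p ++ (u, a) :: (v, a) :: (y, d) :: q' := by simp [hl]
          have n1 : ((p ++ (u, a) :: (v, d) :: (y, a) :: q').map Prod.fst).Nodup := by
            simpa [e1] using hn
          have n2 : ((p ++ (u, d) :: (v, a) :: (y, a) :: q').map Prod.fst).Nodup := by
            simpa [e1] using hn
          have e2 : keyL l = isobaric v y (isobaric u v
              (keyL (p ++ (u, d) :: (v, a) :: (y, a) :: q'))) := by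
            rw [← keyL_of_lt p _ hcd n1, e, keyL_of_lt _ _ hcd (e ▸ hn), ht]
            simp
          have h1 : v ≠ y := by
            rintro rfl
            simp [e1, List.nodup_append] at hn
          have h2 : u ≠ y := by
            rintro rfl
            simp [e1, List.nodup_append] at hn
          have h3 : isobaric v y (keyL (p ++ (u, d) :: (v, a) :: (y, a) :: q')) =
              keyL (p ++ (u, d) :: (v, a) :: (y, a) :: q') := by
            refine ih _ ?_ _ n2 (p ++ [(u, d)]) q' v y a (by simp) rfl
            refine (listWeight_lt p ((y, a) :: q') hcd).trans ?_
            simpa [ht] using hw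
          rw [e2, isobaric_braid huv h1 h2, h3]
        | z :: z' :: t, ht, ht' =>
          simp at ht'
          obtain ⟨rfl, rfl, rfl⟩ := ht'
          have hn' := hn
          simp only [hl, List.map_append, List.map_cons, List.nodup_append, List.nodup_cons,
            List.mem_append, List.mem_cons] at hn'
          refine commuting p (t ++ (x, d) :: (y, c) :: q') (by simp [ht]) ?_ ?_ ?_ ?_ ?_ <;>
            rintro rfl <;> simp at hn'
      · match t, ht, ht' with
        | [], _, ht' => simp at ht'; omega
        -- The mirror case: entries `c, d, d` with `c < d`, reached from `d, d, c`.
        | [z], ht, ht' =>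
          simp at ht'
          obtain ⟨rfl, ⟨rfl, rfl⟩, rfl⟩ := ht'
          have e1 : l = p' ++ (x, c) :: (y, d) :: (v, d) :: q := by simp [e]
          have n1 : ((p' ++ (x, d) :: (y, c) :: (v, d) :: q).map Prod.fst).Nodup := by
            simpa [e1] using hn
          have n2 : ((p' ++ (x, d) :: (y, d) :: (v, c) :: q).map Prod.fst).Nodup := by
            simpa [e1] using hn
          have e2 : keyL l = isobaric x y (isobaric y v
              (keyL (p' ++ (x, d) :: (y, d) :: (v, c) :: q))) := by
            have := keyL_of_lt (p' ++ [(x, d)]) q hcd (by simpa using n1)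
            simp only [List.append_assoc, List.singleton_append] at this
            rw [← this, e, keyL_of_lt _ _ hcd (e ▸ hn)]
          have h1 : x ≠ y := by
            rintro rfl
            simp [e1, List.nodup_append] at hn
          have h2 : x ≠ v := by
            rintro rfl
            simp [e1, List.nodup_append] at hn
          have h3 : isobaric x y (keyL (p' ++ (x, d) :: (y, d) :: (v, c) :: q)) =
              keyL (p' ++ (x, d) :: (y, d) :: (v, c) :: q) := by
            refine ih _ ?_ _ n2 p' ((v, c) :: q) x y d (by simp) rfl
            have := listWeight_lt (u := y) (v := v) (p' ++ [(x, d)]) q hcd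
            simp only [List.append_assoc, List.singleton_append] at this
            exact this.trans hw
          rw [e2, ← isobaric_braid h1 huv h2, h3]
        | z :: z' :: t, ht, ht' =>
          simp at ht'
          obtain ⟨rfl, rfl, rfl⟩ := ht'
          have hn' := hn
          simp only [e, List.map_append, List.map_cons, List.nodup_append, List.nodup_cons,
            List.mem_append, List.mem_cons] at hn'
          refine commuting (p' ++ (x, d) :: (y, c) :: t) q (by simp) ?_ ?_ ?_ ?_ ?_ <;>
            rintro rfl <;> simp at hn'

/-- A key polynomial is symmetric in two adjacent variables with weakly increasing exponents. -/
theorem keyL_swap_of_le (p q : List (σ × ℕ)) {u v : σ} {a b : ℕ} (hab : a ≤ b)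
    (hn : ((p ++ (u, a) :: (v, b) :: q).map Prod.fst).Nodup) :
    keyL (p ++ (v, a) :: (u, b) :: q) = keyL (p ++ (u, a) :: (v, b) :: q) := by
  have huv := ne_of_nodup_append_cons_cons hn
  obtain ⟨hu, hu'⟩ := notMem_of_nodup_append_cons hn
  obtain ⟨hv, hv'⟩ := notMem_of_nodup_append_cons (a := b) (p := p ++ [(u, a)]) (by simpa using hn)
  simp only [List.map_append, List.map_cons, List.map_nil, List.mem_append, not_or] at hv
  -- Exchanging the names `u` and `v` is the action of `swapVars`, so invariance suffices. For `a <
  -- b` the polynomial is a value of the divided difference, hence symmetric.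
  have hs : swapVars u v (keyL (p ++ (u, a) :: (v, b) :: q)) =
      keyL (p ++ (u, a) :: (v, b) :: q) := by
    rcases hab.eq_or_lt with rfl | hlt
    · rw [← isobaric_eq_self_iff huv]
      exact isobaric_keyL_of_eq _ hn p q u v a rfl
    · rw [keyL_of_lt p q hlt hn, swapVars_isobaric huv]
  rw [← hs, swapVars, rename_keyL]
  simp [map_swap_eq_self hu hv.1,
    map_swap_eq_self (l := q) (u := u) (v := v) (fun h => hu' (by simp [h])) hv']

end ListKey

/-! ### Degrees and extreme coefficients in one variable -/

section ListKey

variable {σ : Type*} [DecidableEq σ]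

/-- A polynomial as a polynomial in the variable `u`, with coefficients not involving `u`. -/
def splitVar (u : σ) : MvPolynomial σ ℚ →ₐ[ℚ] Polynomial (MvPolynomial σ ℚ) :=
  aeval fun v => if v = u then Polynomial.X else Polynomial.C (X v)

theorem splitVar_X_self (u : σ) : splitVar u (X u) = Polynomial.X := by
  simp [splitVar]

theorem splitVar_X_of_ne {u v : σ} (h : v ≠ u) : splitVar u (X v) = Polynomial.C (X v) := by
  simp [splitVar, h]

theorem splitVar_rename (e : Equiv.Perm σ) (u : σ) (f : MvPolynomial σ ℚ) :
    splitVar (e u) (rename e f) =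
      (splitVar u f).map (rename e : MvPolynomial σ ℚ →ₐ[ℚ] _).toRingHom := by
  have h : (splitVar (e u)).comp (rename e) =
      (Polynomial.mapAlgHom (rename e : MvPolynomial σ ℚ →ₐ[ℚ] _)).comp (splitVar u) := by
    apply MvPolynomial.algHom_ext
    intro k
    by_cases hk : k = u
    · subst hk
      simp [splitVar_X_self]
    · simp [splitVar_X_of_ne hk, splitVar_X_of_ne (e.injective.ne hk)]
  exact DFunLike.congr_fun h f

theorem splitVar_swapVars_right (x y : σ) (f : MvPolynomial σ ℚ) :
    splitVar y (swapVars x y f) = (splitVar x f).map (swapVars x y).toRingHom := by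
  have := splitVar_rename (Equiv.swap x y) x f
  rwa [Equiv.swap_apply_left] at this

theorem splitVar_swapVars_left (x y : σ) (f : MvPolynomial σ ℚ) :
    splitVar x (swapVars x y f) = (splitVar y f).map (swapVars x y).toRingHom := by
  have := splitVar_rename (Equiv.swap x y) y f
  rwa [Equiv.swap_apply_right] at this

theorem splitVar_swapVars_of_ne {x y u : σ} (hx : u ≠ x) (hy : u ≠ y) (f : MvPolynomial σ ℚ) :
    splitVar u (swapVars x y f) = (splitVar u f).map (swapVars x y).toRingHom := by
  have := splitVar_rename (Equiv.swap x y) u f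
  rwa [Equiv.swap_apply_of_ne_of_ne hx hy] at this

/-- The defining identity of `isobaric x y` involves neither multiplication by `u` nor renaming of
it, so it holds coefficientwise in `u`. -/
theorem coeff_splitVar_isobaric_of_ne {x y u : σ} (hxy : x ≠ y) (hx : u ≠ x) (hy : u ≠ y)
    (f : MvPolynomial σ ℚ) (m : ℕ) :
    (splitVar u (isobaric x y f)).coeff m = isobaric x y ((splitVar u f).coeff m) := by
  refine (isobaric_unique hxy ?_).symm
  have := congrArg (fun g => (splitVar u g).coeff m) (isobaric_spec x y f)
  simp only [map_mul, map_sub, splitVar_X_of_ne hx.symm, splitVar_X_of_ne hy.symm,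
    splitVar_swapVars_of_ne hx hy, sub_mul, Polynomial.coeff_sub, Polynomial.coeff_C_mul,
    Polynomial.coeff_map] at this
  rw [sub_mul]
  exact this

theorem isobaric_zero {x y : σ} (hxy : x ≠ y) : isobaric x y (0 : MvPolynomial σ ℚ) = 0 :=
  isobaric_unique hxy (by simp)

theorem natDegree_splitVar_isobaric_of_ne {x y u : σ} (hxy : x ≠ y) (hx : u ≠ x) (hy : u ≠ y)
    {f : MvPolynomial σ ℚ} {m : ℕ} (hm : (splitVar u f).natDegree ≤ m) :
    (splitVar u (isobaric x y f)).natDegree ≤ m := by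
  rw [Polynomial.natDegree_le_iff_coeff_eq_zero] at hm ⊢
  intro k hk
  rw [coeff_splitVar_isobaric_of_ne hxy hx hy, hm k hk, isobaric_zero hxy]

theorem splitVar_isobaric_right {x y : σ} (hxy : x ≠ y) (f : MvPolynomial σ ℚ) :
    (Polynomial.C (X x) - Polynomial.X) * splitVar y (isobaric x y f) =
      Polynomial.C (X x) * splitVar y f -
        Polynomial.X * (splitVar x f).map (swapVars x y).toRingHom := by
  simpa [splitVar_X_self, splitVar_X_of_ne hxy, splitVar_swapVars_right] using
    congrArg (splitVar y) (isobaric_spec x y f)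

/-- Multiplication by `x - y` raises the degree in `y` by exactly one, while the right side of the
defining identity has degree at most `m + 1`. -/
theorem natDegree_splitVar_isobaric_right {x y : σ} (hxy : x ≠ y) {f : MvPolynomial σ ℚ} {m : ℕ}
    (hx : (splitVar x f).natDegree ≤ m) (hy : (splitVar y f).natDegree ≤ m) :
    (splitVar y (isobaric x y f)).natDegree ≤ m := by
  by_contra! hlt
  have hne : splitVar y (isobaric x y f) ≠ 0 := by
    intro h
    simp [h] at hlt
  have h1 : (Polynomial.C (X x) - Polynomial.X : Polynomial (MvPolynomial σ ℚ)).natDegree = 1 := by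
    rw [← neg_sub, Polynomial.natDegree_neg, Polynomial.natDegree_X_sub_C]
  have h0 : (Polynomial.C (X x) - Polynomial.X : Polynomial (MvPolynomial σ ℚ)) ≠ 0 := by
    intro h
    simp [h] at h1
  have h2 := congrArg Polynomial.natDegree (splitVar_isobaric_right hxy f)
  rw [Polynomial.natDegree_mul h0 hne, h1] at h2
  have h3 := Polynomial.natDegree_sub_le (Polynomial.C (X x) * splitVar y f)
    (Polynomial.X * (splitVar x f).map (swapVars x y).toRingHom)
  have h4 := Polynomial.natDegree_C_mul_le (X x) (splitVar y f)
  have h5 := Polynomial.natDegree_mul_le (p := Polynomial.X)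
    (q := (splitVar x f).map (swapVars x y).toRingHom)
  have h6 := Polynomial.natDegree_map_le (f := (swapVars x y).toRingHom) (p := splitVar x f)
  have h7 := Polynomial.natDegree_X_le (R := MvPolynomial σ ℚ)
  omega

theorem natDegree_splitVar_isobaric_left {x y : σ} (hxy : x ≠ y) {f : MvPolynomial σ ℚ} {m : ℕ}
    (hx : (splitVar x f).natDegree ≤ m) (hy : (splitVar y f).natDegree ≤ m) :
    (splitVar x (isobaric x y f)).natDegree ≤ m := by
  rw [← swapVars_isobaric hxy, splitVar_swapVars_left]
  exact Polynomial.natDegree_map_le.trans (natDegree_splitVar_isobaric_right hxy hx hy)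

/-- Comparison of the coefficients of `y ^ (m + 1)` in the defining identity: only the terms
carrying a factor `y` reach this degree. -/
theorem coeff_splitVar_isobaric_right {x y : σ} (hxy : x ≠ y) {f : MvPolynomial σ ℚ} {m : ℕ}
    (hx : (splitVar x f).natDegree ≤ m) (hy : (splitVar y f).natDegree ≤ m) :
    (splitVar y (isobaric x y f)).coeff m = swapVars x y ((splitVar x f).coeff m) := by
  have h := congrArg (fun g => g.coeff (m + 1)) (splitVar_isobaric_right hxy f)
  have h1 := Polynomial.coeff_eq_zero_of_natDegree_lt (Nat.lt_succ_of_le hy)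
  have h2 := Polynomial.coeff_eq_zero_of_natDegree_lt
    (Nat.lt_succ_of_le (natDegree_splitVar_isobaric_right hxy hx hy))
  simpa [sub_mul, h1, h2] using h

theorem splitVar_prod_of_ne (u : σ) (l : List (σ × ℕ)) (hl : u ∉ l.map Prod.fst) :
    splitVar u (l.map fun x => X x.1 ^ x.2).prod =
      Polynomial.C (l.map fun x => X x.1 ^ x.2).prod := by
  induction l with
  | nil => simp
  | cons x l ih =>
    simp only [List.map_cons, List.mem_cons, not_or] at hl
    simp [ih hl.2, splitVar_X_of_ne (Ne.symm hl.1)]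

theorem splitVar_keyL_of_isChain (p q : List (σ × ℕ)) (u : σ) (a : ℕ)
    (hn : ((p ++ (u, a) :: q).map Prod.fst).Nodup)
    (h : (p ++ (u, a) :: q).IsChain fun x y => y.2 ≤ x.2) :
    splitVar u (keyL (p ++ (u, a) :: q)) = Polynomial.C (keyL (p ++ q)) * Polynomial.X ^ a := by
  have h' : (p ++ q).IsChain fun x y => y.2 ≤ x.2 := by
    have : Trans (fun x y : σ × ℕ => y.2 ≤ x.2) (fun x y : σ × ℕ => y.2 ≤ x.2)
        (fun x y : σ × ℕ => y.2 ≤ x.2) := ⟨fun h1 h2 => le_trans h2 h1⟩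
    exact h.sublist (by simp)
  obtain ⟨h1, h2⟩ := notMem_of_nodup_append_cons hn
  rw [keyL_of_isChain _ h, keyL_of_isChain _ h']
  simp only [List.map_append, List.prod_append, List.map_cons, List.prod_cons, map_mul, map_pow,
    splitVar_prod_of_ne u p h1, splitVar_prod_of_ne u q h2, splitVar_X_self]
  ring

/-- The degree of a key polynomial in a variable is at most the largest exponent in or after
the position of that variable. -/
theorem natDegree_splitVar_keyL_le (l : List (σ × ℕ)) (hn : (l.map Prod.fst).Nodup)
    (p q : List (σ × ℕ)) (u : σ) (a m : ℕ) (hl : l = p ++ (u, a) :: q) (ha : a ≤ m)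
    (hq : ∀ x ∈ q, x.2 ≤ m) : (splitVar u (keyL l)).natDegree ≤ m := by
  induction l using list_swap_induction generalizing p q u a m with
  | sorted l h =>
    subst hl
    rw [splitVar_keyL_of_isChain p q u a hn h]
    exact (Polynomial.natDegree_C_mul_X_pow_le _ _).trans ha
  | step p' q' x y c d hcd ih =>
    have hn' : ((p' ++ (x, d) :: (y, c) :: q').map Prod.fst).Nodup := by simpa using hn
    have hxy := ne_of_nodup_append_cons_cons hn
    obtain ⟨hx, hx'⟩ := notMem_of_nodup_append_cons hn
    obtain ⟨hy, hy'⟩ := notMem_of_nodup_append_cons (a := d) (p := p' ++ [(x, c)]) (by simpa using hn)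
    rw [keyL_of_lt p' q' hcd hn]
    rcases append_cons_eq_append_cons_cons hl with ⟨t, rfl, rfl⟩ | ⟨rfl, e, rfl⟩ |
      ⟨rfl, e, rfl⟩ | ⟨t, rfl, rfl⟩
    · refine natDegree_splitVar_isobaric_of_ne hxy ?_ ?_
        (ih hn' p (t ++ (x, d) :: (y, c) :: q') u a m (by simp) ha ?_)
      · rintro rfl
        simp at hx
      · rintro rfl
        simp at hy
      · have h1 := hq (x, c)
        have h2 := hq (y, d)
        simp only [List.mem_append, List.mem_cons, true_or, or_true, forall_const] at h1 h2
        intro z hz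
        simp only [List.mem_append, List.mem_cons] at hz
        rcases hz with hz | rfl | rfl | hz
        · exact hq z (by simp [hz])
        · exact h2
        · exact h1
        · exact hq z (by simp [hz])
    · cases e
      -- Undoing the ascent gives `u` the larger exponent `d`, which is still at most `m` because it
      -- stood after `u`.
      have hd : d ≤ m := hq (y, d) (by simp)
      have hq' : ∀ z ∈ q', z.2 ≤ m := fun z hz => hq z (by simp [hz])
      exact natDegree_splitVar_isobaric_left hxy
        (ih hn' p' ((y, c) :: q') x d m rfl hd (by simpa [ha] using hq'))
        (ih hn' (p' ++ [(x, d)]) q' y c m (by simp) ha hq')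
    · cases e
      exact natDegree_splitVar_isobaric_right hxy
        (ih hn' p' ((y, c) :: q') x d m rfl ha (by simpa [hcd.le.trans ha] using hq))
        (ih hn' (p' ++ [(x, d)]) q' y c m (by simp) (hcd.le.trans ha) hq)
    · refine natDegree_splitVar_isobaric_of_ne hxy ?_ ?_
        (ih hn' (p' ++ (x, d) :: (y, c) :: t) q u a m (by simp) ha hq)
      · rintro rfl
        simp at hx'
      · rintro rfl
        simp at hy'

/-- The leading coefficient of a key polynomial in a variable whose exponent `m` is not exceeded
in later positions is the key polynomial with that position removed. -/
theorem coeff_splitVar_keyL (l : List (σ × ℕ)) (hn : (l.map Prod.fst).Nodup)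
    (p q : List (σ × ℕ)) (u : σ) (m : ℕ) (hl : l = p ++ (u, m) :: q)
    (hq : ∀ x ∈ q, x.2 ≤ m) : (splitVar u (keyL l)).coeff m = keyL (p ++ q) := by
  induction l using list_swap_induction generalizing p q u m with
  | sorted l h =>
    subst hl
    rw [splitVar_keyL_of_isChain p q u m hn h]
    simp
  | step p' q' x y c d hcd ih =>
    have hn' : ((p' ++ (x, d) :: (y, c) :: q').map Prod.fst).Nodup := by simpa using hn
    have hxy := ne_of_nodup_append_cons_cons hn
    obtain ⟨hx, hx'⟩ := notMem_of_nodup_append_cons hn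
    obtain ⟨hy, hy'⟩ := notMem_of_nodup_append_cons (a := d) (p := p' ++ [(x, c)]) (by simpa using hn)
    rw [keyL_of_lt p' q' hcd hn]
    rcases append_cons_eq_append_cons_cons hl with ⟨t, rfl, rfl⟩ | ⟨rfl, e, rfl⟩ |
      ⟨rfl, e, rfl⟩ | ⟨t, rfl, rfl⟩
    · have hs : (p ++ t ++ (x, c) :: (y, d) :: q').Sublist
          ((p ++ (u, m) :: t) ++ (x, c) :: (y, d) :: q') := by simp
      rw [coeff_splitVar_isobaric_of_ne hxy, ih hn' p (t ++ (x, d) :: (y, c) :: q') u m (by simp),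
        ← List.append_assoc, ← List.append_assoc, keyL_of_lt _ _ hcd (hn.sublist (hs.map _))]
      · have h1 := hq (x, c)
        have h2 := hq (y, d)
        simp only [List.mem_append, List.mem_cons, true_or, or_true, forall_const] at h1 h2
        intro z hz
        simp only [List.mem_append, List.mem_cons] at hz
        rcases hz with hz | rfl | rfl | hz
        · exact hq z (by simp [hz])
        · exact h2
        · exact h1
        · exact hq z (by simp [hz])
      · rintro rfl
        simp at hx
      · rintro rfl
        simp at hy
    · cases e
      exact absurd (hq (y, d) (by simp)) (not_le.2 hcd)
    · cases e
      -- The larger entry `d` belongs to `u = y`, and to `x` once the ascent is undone. The leading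
      -- coefficient in `x` there has `y` with exponent `c`; the swap renames this `y` to `x`.
      have hq' : ∀ z ∈ (y, c) :: q', z.2 ≤ d := by simpa [hcd.le] using hq
      rw [coeff_splitVar_isobaric_right hxy
        (natDegree_splitVar_keyL_le _ hn' p' ((y, c) :: q') x d d rfl le_rfl hq')
        (natDegree_splitVar_keyL_le _ hn' (p' ++ [(x, d)]) q' y c d (by simp) hcd.le hq),
        ih hn' p' ((y, c) :: q') x d rfl hq', swapVars, rename_keyL]
      simp only [List.map_append, List.map_cons, List.map_nil, List.mem_append, not_or] at hy
      simp [map_swap_eq_self hx hy.1,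
        map_swap_eq_self (l := q') (u := x) (v := y) (fun h => hx' (by simp [h])) hy']
    · have hs : (p' ++ (x, c) :: (y, d) :: (t ++ q)).Sublist
          (p' ++ (x, c) :: (y, d) :: (t ++ (u, m) :: q)) := by simp
      rw [coeff_splitVar_isobaric_of_ne hxy,
        ih hn' (p' ++ (x, d) :: (y, c) :: t) q u m (by simp) hq]
      · simpa using (keyL_of_lt _ _ hcd (hn.sublist (hs.map _))).symm
      · rintro rfl
        simp at hx'
      · rintro rfl
        simp at hy'

/-- Setting a variable with exponent zero to zero removes it from a key polynomial. -/
theorem coeff_zero_splitVar_keyL (p q : List (σ × ℕ)) (u : σ)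
    (hn : ((p ++ (u, 0) :: q).map Prod.fst).Nodup) :
    (splitVar u (keyL (p ++ (u, 0) :: q))).coeff 0 = keyL (p ++ q) := by
  induction q generalizing p u with
  | nil => exact coeff_splitVar_keyL _ hn p [] u 0 rfl (by simp)
  | cons z q ih =>
    obtain ⟨v, b⟩ := z
    have huv := ne_of_nodup_append_cons_cons hn
    have hn' : ((p ++ (u, b) :: (v, 0) :: q).map Prod.fst).Nodup := by simpa using hn
    obtain ⟨hu, hu'⟩ := notMem_of_nodup_append_cons hn
    obtain ⟨hv, hv'⟩ := notMem_of_nodup_append_cons (a := b) (p := p ++ [(u, 0)]) (by simpa using hn)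
    simp only [List.map_append, List.map_cons, List.map_nil, List.mem_append, not_or] at hv
    have hs := ih (p ++ [(u, b)]) v (by simpa using hn')
    simp only [List.append_assoc, List.singleton_append] at hs
    -- The zero moves one place to the right, up to renaming. At the end of the list no later
    -- exponent exceeds it, so the constant term is the coefficient computed by
    -- `coeff_splitVar_keyL`.
    have key : (splitVar u (keyL (p ++ (u, 0) :: (v, b) :: q))).coeff 0 =
        swapVars u v ((splitVar v (keyL (p ++ (u, b) :: (v, 0) :: q))).coeff 0) := by
      rcases Nat.eq_zero_or_pos b with rfl | hb
      · conv_lhs => rw [← keyL_swap_of_le p q le_rfl hn]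
        have := rename_keyL (Equiv.swap u v) (p ++ (u, 0) :: (v, 0) :: q)
        simp only [List.map_append, List.map_cons, Equiv.swap_apply_left, Equiv.swap_apply_right,
          map_swap_eq_self hu hv.1,
          map_swap_eq_self (l := q) (u := u) (v := v) (fun h => hu' (by simp [h])) hv'] at this
        rw [← this]
        change (splitVar u (swapVars u v _)).coeff 0 = _
        rw [splitVar_swapVars_left]
        simp
      · rw [keyL_of_lt p q hb hn, ← swapVars_isobaric huv, splitVar_swapVars_left]
        -- In the constant term in `v`, everything multiplied by `v` vanishes and the common factor
        -- `X u` cancels.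
        have h := congrArg (fun g => g.coeff 0)
          (splitVar_isobaric_right huv (keyL (p ++ (u, b) :: (v, 0) :: q)))
        simp only [sub_mul, Polynomial.coeff_sub, Polynomial.coeff_C_mul,
          Polynomial.coeff_X_mul_zero, sub_zero] at h
        simpa using congrArg (swapVars u v) (mul_left_cancel₀ (X_ne_zero u) h)
    rw [key, hs, swapVars, rename_keyL]
    simp [map_swap_eq_self hu hv.1,
      map_swap_eq_self (l := q) (u := u) (v := v) (fun h => hu' (by simp [h])) hv']

end ListKey

/-! ### Homogeneity and linear independence of key polynomials -/

section ListKey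

variable {σ : Type*}

theorem mem_of_coeff_keyL_ne_zero {l : List (σ × ℕ)} {d : σ →₀ ℕ}
    (h : (keyL l).coeff d ≠ 0) {u : σ} (hu : d u ≠ 0) : u ∈ l.map Prod.fst := by
  classical
  obtain ⟨e, rfl, -⟩ := coeff_rename_ne_zero _ _ _ h
  have := Finsupp.mapDomain_support (Finsupp.mem_support_iff.2 hu)
  obtain ⟨k, -, rfl⟩ := Finset.mem_image.1 this
  exact List.mem_map_of_mem (List.get_mem l k)

theorem homogeneousComponent_X_mul (i : σ) (f : MvPolynomial σ ℚ) (n : ℕ) :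
    homogeneousComponent (n + 1) (X i * f) = X i * homogeneousComponent n f := by
  classical
  ext d
  rw [coeff_homogeneousComponent, coeff_X_mul', coeff_X_mul', coeff_homogeneousComponent]
  by_cases hi : i ∈ d.support
  · have hd : d.degree = (d - Finsupp.single i 1).degree + 1 := by
      have : d = (d - Finsupp.single i 1) + Finsupp.single i 1 := by
        refine (tsub_add_cancel_of_le ?_).symm
        rw [Finsupp.single_le_iff]
        exact Nat.one_le_iff_ne_zero.2 (Finsupp.mem_support_iff.1 hi)
      conv_lhs => rw [this]
      simp
    simp only [hd, hi, if_true, Nat.add_right_cancel_iff]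
  · simp [hi]

variable [DecidableEq σ]

/-- The degree `n + 1` part of the defining identity shows that the degree `n` component of the
quotient solves the same equation, so it is the whole quotient. -/
theorem isHomogeneous_isobaric {i j : σ} (hij : i ≠ j) {f : MvPolynomial σ ℚ} {n : ℕ}
    (hf : f.IsHomogeneous n) : (isobaric i j f).IsHomogeneous n := by
  have h := congrArg (homogeneousComponent (n + 1)) (isobaric_spec i j f)
  rw [sub_mul, map_sub, map_sub] at h
  simp only [homogeneousComponent_X_mul] at h
  have hs : (swapVars i j f).IsHomogeneous n := hf.rename_isHomogeneous
  rw [homogeneousComponent_eq_self hf, homogeneousComponent_eq_self hs, ← sub_mul] at h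
  rw [isobaric_unique hij h]
  exact homogeneousComponent_isHomogeneous _ _

theorem isHomogeneous_keyL (l : List (σ × ℕ)) (hn : (l.map Prod.fst).Nodup) :
    (keyL l).IsHomogeneous (l.map Prod.snd).sum := by
  induction l using list_swap_induction with
  | sorted l h =>
    rw [keyL_of_isChain l h]
    clear h hn
    induction l with
    | nil => simpa using isHomogeneous_one σ ℚ
    | cons x l ih => simpa using (isHomogeneous_X_pow x.1 x.2).mul ih
  | step p q u v a b hab ih =>
    rw [keyL_of_lt p q hab hn]
    convert isHomogeneous_isobaric (ne_of_nodup_append_cons_cons hn) (ih (by simpa using hn)) using 1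
    simp
    omega

/-- The coefficient extraction from polynomials in a variable, as a linear map. -/
def splitCoeff (u : σ) (m : ℕ) : MvPolynomial σ ℚ →ₗ[ℚ] MvPolynomial σ ℚ :=
  ((Polynomial.lcoeff (MvPolynomial σ ℚ) m).restrictScalars ℚ).comp (splitVar u).toLinearMap

theorem splitCoeff_apply (u : σ) (m : ℕ) (f : MvPolynomial σ ℚ) :
    splitCoeff u m f = (splitVar u f).coeff m := rfl

/-- Nothing follows the last entry, so it bounds the degree in the last variable, and the
coefficient at that degree is the key polynomial of the remaining entries. In a relation, the terms
of maximal last entry thus give a relation in one variable less. -/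
theorem linearIndependent_keyL_ofFn (n : ℕ) (v : Fin n → σ) (hv : Function.Injective v) :
    LinearIndependent ℚ fun a : Fin n → ℕ => keyL (List.ofFn fun k => (v k, a k)) := by
  induction n with
  | zero =>
    rw [linearIndependent_unique_iff]
    simp [keyL_of_isChain]
  | succ n ih =>
    have ih' := ih (fun k => v k.castSucc) (hv.comp (Fin.castSucc_injective n))
    have hsplit : ∀ a : Fin (n + 1) → ℕ, List.ofFn (fun k => (v k, a k)) =
        (List.ofFn fun k : Fin n => (v k.castSucc, a k.castSucc)) ++
          (v (Fin.last n), a (Fin.last n)) :: [] := by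
      intro a
      rw [List.ofFn_succ', List.concat_eq_append]
    have hnd : ∀ a : Fin (n + 1) → ℕ, ((List.ofFn fun k => (v k, a k)).map Prod.fst).Nodup := by
      intro a
      rw [List.map_ofFn]
      exact List.nodup_ofFn.2 hv
    rw [linearIndependent_iff]
    intro c hc
    by_contra hne
    obtain ⟨a₀, ha₀, hmax⟩ := Finset.exists_max_image c.support (fun a => a (Fin.last n))
      (Finsupp.support_nonempty_iff.2 hne)
    set m := a₀ (Fin.last n) with hm
    have hz := congrArg (splitCoeff (v (Fin.last n)) m) hc
    rw [Finsupp.linearCombination_apply, Finsupp.sum, map_sum, map_zero] at hz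
    have hval : ∀ a ∈ c.support, splitCoeff (v (Fin.last n)) m
        (c a • keyL (List.ofFn fun k => (v k, a k))) = if a (Fin.last n) = m then
          c a • keyL (List.ofFn fun k : Fin n => (v k.castSucc, a k.castSucc)) else 0 := by
      intro a ha
      rw [map_smul, splitCoeff_apply]
      split_ifs with h
      · rw [coeff_splitVar_keyL _ (hnd a) _ [] _ m (by rw [hsplit a, h]) (by simp),
          List.append_nil]
      · rw [Polynomial.coeff_eq_zero_of_natDegree_lt, smul_zero]
        exact (natDegree_splitVar_keyL_le _ (hnd a) _ [] _ _ _ (hsplit a) le_rfl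
          (by simp)).trans_lt (lt_of_le_of_ne (hmax a ha) h)
    rw [Finset.sum_congr rfl hval, ← Finset.sum_filter] at hz
    have hli : LinearIndepOn ℚ (fun a : Fin (n + 1) → ℕ =>
        keyL (List.ofFn fun k : Fin n => (v k.castSucc, a k.castSucc)))
          {a | a (Fin.last n) = m} := by
      refine ih'.comp (fun (a : {a : Fin (n + 1) → ℕ | a (Fin.last n) = m}) k => a.1 k.castSucc) ?_
      intro a b hab
      apply Subtype.ext
      funext k
      refine Fin.lastCases ?_ (fun k => congrFun hab k) k
      exact a.2.trans b.2.symm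
    exact Finsupp.mem_support_iff.1 ha₀ (linearIndepOn_iff'.1 hli _ c (by
      intro a ha
      simpa using (Finset.mem_filter.1 ha).2) hz a₀ (Finset.mem_filter.2 ⟨ha₀, rfl⟩))

/-- Key polynomials are linearly independent. -/
theorem linearIndependent_keyPoly (n : ℕ) :
    LinearIndependent ℚ (keyPoly : (Fin n → ℕ) → MvPolynomial (Fin n) ℚ) := by
  have h := linearIndependent_keyL_ofFn n id Function.injective_id
  simp only [keyL_ofFn, rename_id_apply] at h
  exact h

/-- Evaluating `splitVar u f` at `X u` recovers `f`, and a monomial without `u` sees only the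
constant term. -/
theorem coeff_coeff_zero_splitVar (u : σ) (f : MvPolynomial σ ℚ) {d : σ →₀ ℕ} (hd : d u = 0) :
    ((splitVar u f).coeff 0).coeff d = f.coeff d := by
  have h : (splitVar u f).eval (X u) = f := by
    have : ((Polynomial.aeval (X u : MvPolynomial σ ℚ)).restrictScalars ℚ).comp (splitVar u) =
        AlgHom.id ℚ (MvPolynomial σ ℚ) := by
      apply MvPolynomial.algHom_ext
      intro k
      by_cases hk : k = u
      · subst hk
        simp [splitVar_X_self]
      · simp [splitVar_X_of_ne hk]
    simpa [Polynomial.coe_aeval_eq_eval] using DFunLike.congr_fun this f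
  conv_rhs => rw [← h, ← Polynomial.divX_mul_X_add (splitVar u f)]
  simp [coeff_mul_X', hd]

end ListKey

/-! ### Key polynomials of block compositions -/

section Blocks

variable {σ : Type*}

/-- The list of the variables with exponents of a sequence of blocks. -/
def blockList {r : ℕ} (vs : Fin r → List σ) (b : Fin r → List ℕ) : List (σ × ℕ) :=
  (List.ofFn fun i => (vs i).zip (b i)).flatten

theorem map_fst_blockList {r : ℕ} (vs : Fin r → List σ) (b : Fin r → List ℕ)
    (hb : ∀ i, (b i).length = (vs i).length) :
    (blockList vs b).map Prod.fst = (List.ofFn vs).flatten := by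
  simp only [blockList, List.map_flatten, List.map_ofFn]
  congr 2
  funext i
  simp [List.map_fst_zip (hb i).ge]

variable [DecidableEq σ]

/-- Permutations are generated by adjacent transpositions, and the exponents of the block stay
weakly increasing throughout, so each transposition is an instance of `keyL_swap_of_le`. -/
theorem keyL_block_perm {vs vs' : List σ} (h : vs.Perm vs') :
    ∀ (p q : List (σ × ℕ)) (b : List ℕ), b.length = vs.length → b.Pairwise (· ≤ ·) →
      (p.map Prod.fst ++ vs ++ q.map Prod.fst).Nodup →
      keyL (p ++ vs.zip b ++ q) = keyL (p ++ vs'.zip b ++ q) := by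
  induction h with
  | nil => intros; rfl
  | cons x h ih =>
    intro p q b hb hs hn
    match b, hb, hs with
    | a :: b, hb, hs =>
      have := ih (p ++ [(x, a)]) q b (by simpa using hb) hs.of_cons (by simpa using hn)
      simpa using this
  | swap x y l =>
    intro p q b hb hs hn
    match b, hb, hs with
    | a :: a' :: b, hb, hs =>
      have hle : a ≤ a' := by
        rw [List.pairwise_cons] at hs
        exact hs.1 a' (by simp)
      have := keyL_swap_of_le (u := y) (v := x) p (l.zip b ++ q) hle (by
        have hl : l.length ≤ b.length := by simp at hb; omega
        simpa [List.map_fst_zip hl] using hn)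
      simpa using this.symm
  | trans h₁ h₂ ih₁ ih₂ =>
    intro p q b hb hs hn
    rw [ih₁ p q b hb hs hn, ih₂ p q b (hb.trans h₁.length_eq) hs]
    exact (((h₁.append_left _).append_right _).nodup_iff).1 hn

theorem coeff_keyL_zeros (p q : List (σ × ℕ)) (us : List σ)
    (hn : (p.map Prod.fst ++ us ++ q.map Prod.fst).Nodup) {d : σ →₀ ℕ} (hd : ∀ u ∈ us, d u = 0) :
    (keyL (p ++ us.map (fun u => (u, 0)) ++ q)).coeff d = (keyL (p ++ q)).coeff d := by
  induction us with
  | nil => simp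
  | cons u us ih =>
    have hu := coeff_zero_splitVar_keyL p (us.map (fun u => (u, 0)) ++ q) u
      (by simpa [Function.comp_def] using hn)
    rw [← ih (hn.sublist (by simp)) fun u hu => hd u (by simp [hu]), List.append_assoc p,
      List.append_assoc p, ← hu,
      coeff_coeff_zero_splitVar _ _ (hd u (by simp))]
    simp

/-- Block by block, symmetry brings the variables absent from the monomial to the front, where they
carry the zeros and can be deleted. The prefix `p` collects the blocks already treated. -/
theorem coeff_keyL_blocks {r : ℕ} (p : List (σ × ℕ)) (us vs ws : Fin r → List σ)
    (b : Fin r → List ℕ) (hws : ∀ i, (ws i).Perm (us i ++ vs i))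
    (hb : ∀ i, (b i).length = (vs i).length) (hs : ∀ i, (b i).Pairwise (· ≤ ·))
    (hn : (p.map Prod.fst ++ (List.ofFn ws).flatten).Nodup) {d : σ →₀ ℕ}
    (hd : ∀ i, ∀ u ∈ us i, d u = 0) :
    (keyL (p ++ blockList ws fun i => List.replicate (us i).length 0 ++ b i)).coeff d =
      (keyL (p ++ blockList vs b)).coeff d := by
  induction r generalizing p with
  | zero => simp [blockList]
  | succ r ih =>
    have hlen : ∀ i, (List.replicate (us i).length 0 ++ b i).length = (ws i).length := by
      intro i
      simp [(hws i).length_eq, hb]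
    have hsplit : ∀ (xs : Fin (r + 1) → List σ) (c : Fin (r + 1) → List ℕ), blockList xs c =
        (xs 0).zip (c 0) ++ blockList (fun i => xs i.succ) fun i => c i.succ := by
      intro xs c
      simp [blockList, List.ofFn_succ]
    have hrest := map_fst_blockList (fun i : Fin r => ws i.succ)
      (fun i => List.replicate (us i.succ).length 0 ++ b i.succ) fun i => hlen i.succ
    rw [List.ofFn_succ, List.flatten_cons] at hn
    have hn₁ : (p.map Prod.fst ++ (us 0 ++ vs 0) ++
        (List.ofFn fun i : Fin r => ws i.succ).flatten).Nodup := by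
      rw [← List.append_assoc] at hn
      exact ((((hws 0).append_left _).append_right _).nodup_iff).1 hn
    have hz : (us 0 ++ vs 0).zip (List.replicate (us 0).length 0 ++ b 0) =
        (us 0).map (fun u => (u, 0)) ++ (vs 0).zip (b 0) := by
      rw [List.zip_append (by simp)]
      congr 1
      generalize us 0 = t
      induction t with
      | nil => rfl
      | cons x t ih => simp [List.replicate_succ, ih]
    rw [hsplit ws, hsplit vs, ← List.append_assoc, keyL_block_perm (hws 0) p _ _ (hlen 0) ?_
      (by rw [hrest, List.append_assoc]; exact hn), hz, ← List.append_assoc p, List.append_assoc,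
      coeff_keyL_zeros p _ (us 0) ?_ (hd 0), ← List.append_assoc, ← List.append_assoc]
    · refine ih (p ++ (vs 0).zip (b 0)) _ _ _ _ (fun i => hws i.succ) (fun i => hb i.succ)
        (fun i => hs i.succ) ?_ fun i => hd i.succ
      rw [List.map_append, List.map_fst_zip (hb 0).ge]
      exact hn₁.sublist (by simp)
    · rw [List.map_append, hrest, List.map_fst_zip (hb 0).ge]
      simpa using hn₁
    · rw [List.pairwise_append]
      refine ⟨List.pairwise_replicate.2 (by simp), hs 0, ?_⟩
      intro x hx y _
      rw [List.eq_of_mem_replicate hx]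
      exact Nat.zero_le _

end Blocks

/-! ### Multi-symmetric Schur polynomials in arbitrary lists of variables -/

/-- `finSigmaFinEquiv` enumerates the blocks one after the other; this translates block compositions
into concatenated lists. -/
theorem ofFn_finSigmaFinEquiv_symm {α : Type*} {r : ℕ} {n : Fin r → ℕ}
    (g : (i : Fin r) × Fin (n i) → α) :
    List.ofFn (fun k => g (finSigmaFinEquiv.symm k)) =
      (List.ofFn fun i => List.ofFn fun j => g ⟨i, j⟩).flatten := by
  induction r with
  | zero => simp
  | succ r ih =>
    rw [List.ofFn_congr (Fin.sum_univ_castSucc n), List.ofFn_add, List.ofFn_succ',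
      List.concat_eq_append, List.flatten_append,
      ← ih (n := fun i => n i.castSucc) fun x => g ⟨x.1.castSucc, x.2⟩]
    congr 1
    · congr 1
      funext k
      congr 1
      rw [Equiv.symm_apply_eq]
      apply Fin.ext
      have h := finSigmaFinEquiv_apply (finSigmaFinEquiv.symm k)
      rw [Equiv.apply_symm_apply] at h
      rw [finSigmaFinEquiv_apply]
      exact h
    · simp only [List.flatten_cons, List.flatten_nil, List.append_nil]
      congr 1
      funext k
      congr 1
      rw [Equiv.symm_apply_eq]
      apply Fin.ext
      rw [finSigmaFinEquiv_apply]
      simp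
      rfl

/-- The `n` largest parts of a partition (padded with zeros), in weakly increasing order. -/
def revParts (μ : YoungDiagram) (n : ℕ) : List ℕ := ((List.range n).map μ.rowLen).reverse

theorem length_revParts (μ : YoungDiagram) (n : ℕ) : (revParts μ n).length = n := by
  simp [revParts]

theorem pairwise_revParts (μ : YoungDiagram) (n : ℕ) : (revParts μ n).Pairwise (· ≤ ·) := by
  rw [revParts, List.pairwise_reverse, List.pairwise_map]
  exact List.pairwise_lt_range.imp fun h => μ.rowLen_anti _ _ h.le

/-- The length of the first column is the number of parts `ℓ(μ)`. -/
theorem rowLen_eq_zero {μ : YoungDiagram} {n : ℕ} (h : μ.colLen 0 ≤ n) : μ.rowLen n = 0 := by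
  by_contra hne
  have : (n, 0) ∈ μ := YoungDiagram.mem_iff_lt_rowLen.2 (Nat.pos_of_ne_zero hne)
  exact absurd (YoungDiagram.mem_iff_lt_colLen.1 this) (not_lt.2 h)

theorem revParts_add {μ : YoungDiagram} {n : ℕ} (h : μ.colLen 0 ≤ n) (k : ℕ) :
    revParts μ (k + n) = List.replicate k 0 ++ revParts μ n := by
  rw [revParts, revParts, Nat.add_comm, List.range_add, List.map_append, List.reverse_append]
  congr 1
  rw [List.map_map, List.eq_replicate_iff]
  refine ⟨by simp, fun b hb => ?_⟩
  simp only [List.mem_reverse, List.mem_map, Function.comp] at hb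
  obtain ⟨a, -, rfl⟩ := hb
  exact rowLen_eq_zero (h.trans (Nat.le_add_right _ _))

theorem sum_revParts {μ : YoungDiagram} {n : ℕ} (h : μ.colLen 0 ≤ n) :
    (revParts μ n).sum = μ.card := by
  have hl : ((List.range n).map μ.rowLen).sum = ∑ i ∈ Finset.range n, μ.rowLen i := rfl
  rw [revParts, List.sum_reverse, hl, YoungDiagram.card,
    Finset.card_eq_sum_card_fiberwise (f := Prod.fst) (t := Finset.range n)]
  · exact Finset.sum_congr rfl fun i _ => μ.rowLen_eq_card
  · rintro ⟨i, j⟩ hc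
    have h0 : (i, 0) ∈ μ := μ.up_left_mem le_rfl (Nat.zero_le j) (by simpa using hc)
    simpa using (YoungDiagram.mem_iff_lt_colLen.1 h0).trans_le h

section MultiKey

variable {r : ℕ}

/-- The multi-symmetric Schur polynomial in the variables `x_{i,j}`, `j` running over the list
`vs i`. -/
def multiKey (lam : Fin r → YoungDiagram) (vs : Fin r → List ℕ) : MvPolynomial (Fin r × ℕ) ℚ :=
  keyL (blockList (fun i => (vs i).map (Prod.mk i)) fun i => revParts (lam i) (vs i).length)

theorem multiSchurPoly_eq_multiKey (lam : Fin r → YoungDiagram) (n : Fin r → ℕ) :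
    multiSchurPoly lam n = multiKey lam fun i => List.range (n i) := by
  rw [multiSchurPoly, ← keyL_ofFn, multiKey, blockList]
  congr 1
  refine (ofFn_finSigmaFinEquiv_symm fun x : (i : Fin r) × Fin (n i) =>
    ((x.1, (x.2 : ℕ)), (lam x.1).rowLen x.2.rev)).trans ?_
  congr 2
  funext i
  apply List.ext_getElem
  · simp [length_revParts]
  · intro k h1 h2
    simp [revParts, Fin.val_rev]
    congr 1
    omega

theorem nodup_flatten_map_mk {vs : Fin r → List ℕ} (h : ∀ i, (vs i).Nodup) :
    (List.ofFn fun i => (vs i).map (Prod.mk i)).flatten.Nodup := by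
  rw [List.nodup_flatten]
  constructor
  · intro l hl
    obtain ⟨i, rfl⟩ := (List.mem_ofFn' _ _).1 hl
    exact (h i).map (Prod.mk_right_injective i)
  · rw [List.pairwise_ofFn]
    intro i j hij x hx hy
    simp only [List.mem_map] at hx hy
    obtain ⟨a, -, rfl⟩ := hx
    obtain ⟨b, -, hb⟩ := hy
    exact hij.ne (congrArg Prod.fst hb).symm

theorem map_fst_multiKey (lam : Fin r → YoungDiagram) (vs : Fin r → List ℕ) :
    (blockList (fun i => (vs i).map (Prod.mk i)) fun i =>
      revParts (lam i) (vs i).length).map Prod.fst =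
      (List.ofFn fun i => (vs i).map (Prod.mk i)).flatten :=
  map_fst_blockList _ _ fun i => by simp [length_revParts]

theorem mem_of_coeff_multiKey_ne_zero {lam : Fin r → YoungDiagram} {vs : Fin r → List ℕ}
    {d : Fin r × ℕ →₀ ℕ} (h : (multiKey lam vs).coeff d ≠ 0) {i : Fin r} {j : ℕ}
    (hd : d (i, j) ≠ 0) : j ∈ vs i := by
  have := mem_of_coeff_keyL_ne_zero h hd
  rw [map_fst_multiKey] at this
  simp only [List.mem_flatten, List.mem_ofFn', Set.mem_range, exists_exists_eq_and,
    List.mem_map, Prod.mk.injEq] at this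
  obtain ⟨i', j', hj, rfl, rfl⟩ := this
  exact hj

theorem coeff_multiKey_of_perm (lam : Fin r → YoungDiagram) (us vs ws : Fin r → List ℕ)
    (hws : ∀ i, (ws i).Perm (us i ++ vs i)) (hn : ∀ i, (ws i).Nodup)
    (hl : ∀ i, (lam i).colLen 0 ≤ (vs i).length) {d : Fin r × ℕ →₀ ℕ}
    (hd : ∀ i, ∀ j ∈ us i, d (i, j) = 0) :
    (multiKey lam ws).coeff d = (multiKey lam vs).coeff d := by
  have h := coeff_keyL_blocks [] (fun i => (us i).map (Prod.mk i)) (fun i => (vs i).map (Prod.mk i))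
    (fun i => (ws i).map (Prod.mk i)) (fun i => revParts (lam i) (vs i).length)
    (fun i => by simpa using (hws i).map (Prod.mk i)) (fun i => by simp [length_revParts])
    (fun i => pairwise_revParts _ _) (by simpa using nodup_flatten_map_mk hn) (d := d) (by
      intro i u hu
      obtain ⟨j, hj, rfl⟩ := List.mem_map.1 hu
      exact hd i j hj)
  simp only [List.nil_append] at h
  rw [multiKey, multiKey, ← h]
  congr 3
  funext i
  rw [(hws i).length_eq, List.length_append, List.length_map, revParts_add (hl i)]

/-- The coefficients of a multi-symmetric Schur polynomial do not depend on the set of variables. -/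
theorem coeff_multiKey_of_subset (lam : Fin r → YoungDiagram) (vs ws : Fin r → List ℕ)
    (hsub : ∀ i, vs i ⊆ ws i) (hv : ∀ i, (vs i).Nodup) (hw : ∀ i, (ws i).Nodup)
    (hl : ∀ i, (lam i).colLen 0 ≤ (vs i).length) {d : Fin r × ℕ →₀ ℕ}
    (hd : ∀ i j, d (i, j) ≠ 0 → j ∈ vs i) :
    (multiKey lam ws).coeff d = (multiKey lam vs).coeff d := by
  -- The superfluous variables are those of `ws i` outside `vs i`, where `d` vanishes.
  refine coeff_multiKey_of_perm lam (fun i => (ws i).filter (· ∉ vs i)) vs ws (fun i => ?_) hw hl ?_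
  · refine (List.perm_ext_iff_of_nodup (hw i) ?_).2 fun j => ?_
    · rw [List.nodup_append]
      refine ⟨(hw i).filter _, hv i, fun a ha b hb => ?_⟩
      rintro rfl
      simp [hb] at ha
    · have := @hsub i j
      by_cases hj : j ∈ vs i <;> simp [hj]
      exact this hj
  · intro i j hj
    by_contra hne
    simp [hd i j hne] at hj

theorem rename_multiKey (lam : Fin r → YoungDiagram) (vs : Fin r → List ℕ)
    (s : Fin r → Equiv.Perm ℕ) :
    rename (fun x : Fin r × ℕ => (x.1, s x.1 x.2)) (multiKey lam vs) =
      multiKey lam fun i => (vs i).map (s i) := by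
  rw [multiKey, rename_keyL, multiKey]
  congr 1
  simp only [blockList, List.map_flatten, List.map_ofFn, List.length_map]
  congr 2
  funext i
  simp only [Function.comp, List.map_map]
  rw [← List.map_id (revParts (lam i) (vs i).length), List.zip_map, List.zip_map, List.map_map]
  simp [Function.comp_def]

theorem isHomogeneous_multiKey (lam : Fin r → YoungDiagram) (vs : Fin r → List ℕ)
    (hv : ∀ i, (vs i).Nodup) :
    (multiKey lam vs).IsHomogeneous
      (∑ i, (revParts (lam i) (vs i).length).sum) := by
  have h := isHomogeneous_keyL (blockList (fun i => (vs i).map (Prod.mk i)) fun i =>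
    revParts (lam i) (vs i).length) (by
      rw [map_fst_multiKey]
      exact nodup_flatten_map_mk hv)
  have hs : ((blockList (fun i => (vs i).map (Prod.mk i)) fun i =>
      revParts (lam i) (vs i).length).map Prod.snd).sum =
        ∑ i, (revParts (lam i) (vs i).length).sum := by
    simp only [blockList, List.map_flatten, List.map_ofFn, List.sum_flatten, List.sum_ofFn]
    refine Finset.sum_congr rfl fun i _ => ?_
    simp [List.map_snd_zip, length_revParts]
  rw [hs] at h
  exact h

end MultiKey

/-! ### Monomial symmetric functions -/

/-- The multiset of the nonzero exponents of a monomial. -/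
def exponents (e : ℕ →₀ ℕ) : Multiset ℕ := e.support.val.map e

theorem sum_exponents (e : ℕ →₀ ℕ) : (exponents e).sum = e.degree := rfl

theorem exponents_embDomain (s : ℕ ↪ ℕ) (e : ℕ →₀ ℕ) :
    exponents (e.embDomain s) = exponents e := by
  simp only [exponents, Finsupp.support_embDomain, Finset.map_val, Multiset.map_map]
  exact Multiset.map_congr rfl fun x _ => by simp [Finsupp.embDomain_apply_self]

/-- The fibres over a nonzero value are finite of equal size, and the two fibres over zero are both
countably infinite; bijections of fibres glue to a permutation. -/
theorem exists_perm_of_exponents_eq {e e' : ℕ →₀ ℕ} (h : exponents e = exponents e') :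
    ∃ s : Equiv.Perm ℕ, ∀ j, e' (s j) = e j := by
  suffices H : ∀ c, Nonempty ({a // e a = c} ≃ {b // e' b = c}) from
    ⟨Equiv.ofFiberEquiv fun c => (H c).some, Equiv.ofFiberEquiv_map _⟩
  intro c
  rcases eq_or_ne c 0 with rfl | hc
  · have hinf : ∀ f : ℕ →₀ ℕ, Infinite {a // f a = 0} := by
      intro f
      have : {a | f a = 0} = (f.support : Set ℕ)ᶜ := by
        ext a
        simp
      have h : {a | f a = 0}.Infinite := by
        rw [this]
        exact f.support.finite_toSet.infinite_compl
      exact h.to_subtype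
    have := hinf e
    have := hinf e'
    exact nonempty_equiv_of_countable
  · have hcard : ∀ f : ℕ →₀ ℕ, (f.support.filter fun a => f a = c).card =
        (exponents f).count c := by
      intro f
      rw [exponents, Multiset.count_map]
      simp only [eq_comm (a := c)]
      rfl
    have he : ∀ f : ℕ →₀ ℕ, ∀ a, a ∈ f.support.filter (fun a => f a = c) ↔ f a = c := by
      intro f a
      simp only [Finset.mem_filter, Finsupp.mem_support_iff, and_iff_right_iff_imp]
      exact fun h => h ▸ hc
    exact ⟨(Equiv.subtypeEquivRight (he e)).symm.trans
      ((Finset.equivOfCardEq (by rw [hcard, hcard, h])).trans (Equiv.subtypeEquivRight (he e')))⟩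

/-- The exponent vector of the leading monomial of shape `μ`. -/
def rowExponent (μ : YoungDiagram) : ℕ →₀ ℕ :=
  Finsupp.onFinset (Finset.range (μ.colLen 0)) μ.rowLen fun j hj => by
    rw [Finset.mem_range]
    by_contra h
    exact hj (rowLen_eq_zero (not_lt.1 h))

theorem exponents_rowExponent (μ : YoungDiagram) : exponents (rowExponent μ) = μ.rowLens := by
  have : (rowExponent μ).support = Finset.range (μ.colLen 0) := by
    refine (Finsupp.support_onFinset_subset).antisymm fun j hj => ?_
    rw [Finset.mem_range, ← YoungDiagram.mem_iff_lt_colLen, YoungDiagram.mem_iff_lt_rowLen] at hj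
    exact Finsupp.mem_support_iff.2 hj.ne'
  rw [exponents, this]
  rfl

theorem rowExponent_exponents_injective {μ ν : YoungDiagram}
    (h : exponents (rowExponent μ) = exponents (rowExponent ν)) : μ = ν := by
  rw [exponents_rowExponent, exponents_rowExponent, Multiset.coe_eq_coe] at h
  have := h.eq_of_pairwise' μ.rowLens_sorted.pairwise ν.rowLens_sorted.pairwise
  exact YoungDiagram.equivListRowLens.injective (Subtype.ext this)

/-- The partition formed by the exponents of a monomial. -/
def shape (e : ℕ →₀ ℕ) : YoungDiagram :=
  YoungDiagram.ofRowLens ((exponents e).sort (· ≥ ·)) (Multiset.pairwise_sort _ _).sortedGE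

theorem exponents_rowExponent_shape (e : ℕ →₀ ℕ) :
    exponents (rowExponent (shape e)) = exponents e := by
  rw [exponents_rowExponent, shape, YoungDiagram.rowLens_ofRowLens_eq_self, Multiset.sort_eq]
  intro x hx
  rw [Multiset.mem_sort, exponents, Multiset.mem_map] at hx
  obtain ⟨a, ha, rfl⟩ := hx
  exact Nat.pos_of_ne_zero (Finsupp.mem_support_iff.1 ha)

theorem shape_eq_iff {e : ℕ →₀ ℕ} {μ : YoungDiagram} :
    shape e = μ ↔ exponents e = exponents (rowExponent μ) := by
  rw [← exponents_rowExponent_shape e]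
  exact ⟨fun h => h ▸ rfl, rowExponent_exponents_injective⟩

theorem shape_rowExponent (μ : YoungDiagram) : shape (rowExponent μ) = μ := shape_eq_iff.2 rfl

theorem card_shape (e : ℕ →₀ ℕ) : (shape e).card = e.degree := by
  rw [← sum_exponents, ← exponents_rowExponent_shape, exponents_rowExponent, Multiset.sum_coe,
    ← sum_revParts le_rfl, revParts, List.sum_reverse]
  rfl

/-- The row and column leading to any cell lie in the diagram, so it fits into an `N × N` square. -/
theorem finite_card_le (N : ℕ) : {μ : YoungDiagram | μ.card ≤ N}.Finite := by
  refine Set.Finite.of_finite_image (f := YoungDiagram.cells)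
    ((Finset.finite_toSet (Finset.range N ×ˢ Finset.range N).powerset).subset ?_)
    fun μ _ ν _ h => YoungDiagram.ext h
  rintro _ ⟨μ, hμ, rfl⟩
  simp only [Finset.coe_powerset, Set.mem_preimage, Set.mem_powerset_iff, Finset.coe_subset]
  rintro ⟨i, j⟩ hc
  have hc' : (i, j) ∈ μ := by simpa using hc
  have h1 : ((Finset.range (i + 1)).map ⟨fun a => (a, 0), fun a b h => congrArg Prod.fst h⟩).card ≤
      μ.card := by
    refine Finset.card_le_card fun x hx => ?_
    obtain ⟨a, ha, rfl⟩ := Finset.mem_map.1 hx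
    exact (YoungDiagram.mem_cells _).2
      (μ.up_left_mem (Nat.lt_succ_iff.1 (Finset.mem_range.1 ha)) (Nat.zero_le j) hc')
  have h2 : ((Finset.range (j + 1)).map ⟨fun a => (0, a), fun a b h => congrArg Prod.snd h⟩).card ≤
      μ.card := by
    refine Finset.card_le_card fun x hx => ?_
    obtain ⟨a, ha, rfl⟩ := Finset.mem_map.1 hx
    exact (YoungDiagram.mem_cells _).2
      (μ.up_left_mem (Nat.zero_le i) (Nat.lt_succ_iff.1 (Finset.mem_range.1 ha)) hc')
  rw [Finset.card_map, Finset.card_range] at h1 h2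
  have hN : μ.card ≤ N := hμ
  simp only [Finset.mem_product, Finset.mem_range]
  omega

theorem coeff_eq_of_exponents_eq (f : SymmFun) {e e' : ℕ →₀ ℕ} (h : exponents e = exponents e') :
    MvPowerSeries.coeff e (f : MvPowerSeries ℕ ℚ) = MvPowerSeries.coeff e' (f : MvPowerSeries ℕ ℚ) := by
  obtain ⟨s, hs⟩ := exists_perm_of_exponents_eq h
  have he : e' = e.embDomain s.toEmbedding := by
    ext j
    obtain ⟨k, rfl⟩ := s.surjective j
    rw [hs]
    exact (Finsupp.embDomain_apply_self s.toEmbedding e k).symm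
  have h1 := MvPowerSeries.coeff_embDomain_rename s.toEmbedding (f : MvPowerSeries ℕ ℚ) e
  rw [← he] at h1
  rw [← h1]
  exact congrArg (MvPowerSeries.coeff e') (f.2.2 s)

open Classical in
/-- The monomial symmetric function of a partition. -/
def monomialSymm (μ : YoungDiagram) : SymmFun :=
  ⟨fun e => if shape e = μ then 1 else 0, by
    refine ⟨⟨μ.card, fun e he => ?_⟩, fun s => ?_⟩
    · have : shape e = μ := by
        by_contra h
        exact he (if_neg h)
      rw [← card_shape, this]
    · ext e
      obtain ⟨e, rfl⟩ : ∃ e', e = Finsupp.embDomain s.toEmbedding e' := by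
        refine ⟨e.embDomain s.symm.toEmbedding, ?_⟩
        ext j
        obtain ⟨k, rfl⟩ := s.surjective j
        have h1 := Finsupp.embDomain_apply_self s.toEmbedding (e.embDomain s.symm.toEmbedding) k
        have h2 := Finsupp.embDomain_apply_self s.symm.toEmbedding e (s k)
        simp only [Equiv.coe_toEmbedding, Equiv.symm_apply_apply] at h1 h2
        rw [h1, h2]
      refine (MvPowerSeries.coeff_embDomain_rename s.toEmbedding _ e).trans ?_
      change (if shape e = μ then (1 : ℚ) else 0) = if shape _ = μ then 1 else 0
      simp only [shape_eq_iff, exponents_embDomain]⟩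

open Classical in
theorem coeff_monomialSymm (μ : YoungDiagram) (e : ℕ →₀ ℕ) :
    MvPowerSeries.coeff e (monomialSymm μ : MvPowerSeries ℕ ℚ) = if shape e = μ then 1 else 0 :=
  rfl

/-- The coefficients of symmetric functions, as linear maps. -/
def symmCoeff (e : ℕ →₀ ℕ) : SymmFun →ₗ[ℚ] ℚ :=
  (MvPowerSeries.coeff e).comp SymmFun.val.toLinearMap

theorem symmCoeff_apply (e : ℕ →₀ ℕ) (f : SymmFun) :
    symmCoeff e f = MvPowerSeries.coeff e (f : MvPowerSeries ℕ ℚ) := rfl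

/-- The basis of monomial symmetric functions. -/
def monomialBasis : Module.Basis YoungDiagram ℚ SymmFun :=
  Module.Basis.mk (v := monomialSymm) (by
    classical
    rw [linearIndependent_iff]
    intro c hc
    ext μ
    have := congrArg (symmCoeff (rowExponent μ)) hc
    rw [Finsupp.linearCombination_apply, Finsupp.sum, map_sum] at this
    simpa [symmCoeff_apply, coeff_monomialSymm, shape_rowExponent] using this) (by
    classical
    rintro f -
    obtain ⟨N, hN⟩ := f.2.1
    -- Bounded degree leaves finitely many shapes, and the coefficient of a monomial in `f` depends
    -- only on its shape.
    have hf : f = ∑ μ ∈ (finite_card_le N).toFinset,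
        symmCoeff (rowExponent μ) f • monomialSymm μ := by
      apply Subtype.ext
      ext e
      rw [← symmCoeff_apply, ← symmCoeff_apply, map_sum]
      simp only [map_smul, symmCoeff_apply, coeff_monomialSymm, smul_eq_mul, mul_ite, mul_one,
        mul_zero, Finset.sum_ite_eq, Set.Finite.mem_toFinset, Set.mem_ofPred_eq]
      rw [coeff_eq_of_exponents_eq f (exponents_rowExponent_shape e)]
      split_ifs with h
      · rfl
      · by_contra hne
        exact h (card_shape e ▸ hN e hne)
    rw [hf]
    exact Submodule.sum_mem _ fun μ _ => Submodule.smul_mem _ _ (Submodule.subset_span ⟨μ, rfl⟩))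

theorem monomialBasis_apply (μ : YoungDiagram) : monomialBasis μ = monomialSymm μ := by
  simp [monomialBasis]

/-! ### Expansions of multi-symmetric functions -/

section Expansion

variable {r : ℕ}

/-- The exponents of the `i`-th set of variables. -/
def block (d : Fin r × ℕ →₀ ℕ) (i : Fin r) : ℕ →₀ ℕ :=
  d.comapDomain (Prod.mk i) (Prod.mk_right_injective i).injOn

theorem block_apply (d : Fin r × ℕ →₀ ℕ) (i : Fin r) (j : ℕ) : block d i j = d (i, j) := rfl

theorem sum_embDomain_apply (e : Fin r → ℕ →₀ ℕ) (i : Fin r) (j : ℕ) :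
    (∑ k, (e k).embDomain ⟨Prod.mk k, Prod.mk_right_injective k⟩) (i, j) = e i j := by
  rw [Finsupp.finsetSum_apply, Finset.sum_eq_single i]
  · exact Finsupp.embDomain_apply_self ⟨Prod.mk i, Prod.mk_right_injective i⟩ (e i) j
  · intro k _ hk
    refine Finsupp.embDomain_of_notMem_range _ _ _ ?_
    rintro ⟨a, ha⟩
    exact hk (congrArg Prod.fst ha)
  · simp

theorem block_sum_embDomain (e : Fin r → ℕ →₀ ℕ) (i : Fin r) :
    block (∑ k, (e k).embDomain ⟨Prod.mk k, Prod.mk_right_injective k⟩) i = e i := by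
  ext j
  rw [block_apply, sum_embDomain_apply]

theorem sum_embDomain_block (d : Fin r × ℕ →₀ ℕ) :
    ∑ k, (block d k).embDomain ⟨Prod.mk k, Prod.mk_right_injective k⟩ = d := by
  ext ⟨i, j⟩
  rw [sum_embDomain_apply, block_apply]

theorem degree_eq_sum_block (d : Fin r × ℕ →₀ ℕ) : d.degree = ∑ i, (block d i).degree := by
  conv_lhs => rw [← sum_embDomain_block d, map_sum]
  refine Finset.sum_congr rfl fun i _ => ?_
  rw [Finsupp.embDomain_eq_mapDomain, Finsupp.degree_mapDomain]

theorem expand_tprod (f : Fin r → SymmFun) :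
    expand r (PiTensorProduct.tprod ℚ f) =
      ∏ i, MvPowerSeries.rename (Prod.mk i) (f i : MvPowerSeries ℕ ℚ) := by
  simp [expand]

/-- A monomial factors uniquely into monomials in the separate sets of variables, so one term of the
product formula survives. -/
theorem coeff_expand_tprod (f : Fin r → SymmFun) (d : Fin r × ℕ →₀ ℕ) :
    MvPowerSeries.coeff d (expand r (PiTensorProduct.tprod ℚ f)) =
      ∏ i, MvPowerSeries.coeff (block d i) (f i : MvPowerSeries ℕ ℚ) := by
  classical
  let l₀ : Fin r →₀ (Fin r × ℕ →₀ ℕ) := Finsupp.equivFunOnFinite.symm fun i =>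
    (block d i).embDomain ⟨Prod.mk i, Prod.mk_right_injective i⟩
  rw [expand_tprod, MvPowerSeries.coeff_prod, Finset.sum_eq_single l₀]
  · refine Finset.prod_congr rfl fun i _ => ?_
    exact MvPowerSeries.coeff_embDomain_rename ⟨Prod.mk i, Prod.mk_right_injective i⟩ _ _
  · intro l hl hne
    by_contra h
    have hr : ∀ i, ∃ e : ℕ →₀ ℕ, e.embDomain ⟨Prod.mk i, Prod.mk_right_injective i⟩ = l i := by
      intro i
      by_contra hi
      refine h (Finset.prod_eq_zero (Finset.mem_univ i) (MvPowerSeries.coeff_rename_eq_zero _ _ ?_))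
      rintro ⟨e, he⟩
      exact hi ⟨e, by rw [Finsupp.embDomain_eq_mapDomain]; exact he⟩
    choose e he using hr
    refine hne (Finsupp.ext fun i => ?_)
    have hd : d = ∑ k, (e k).embDomain ⟨Prod.mk k, Prod.mk_right_injective k⟩ := by
      rw [← (Finset.mem_finsuppAntidiag.1 hl).1]
      exact Finset.sum_congr rfl fun k _ => (he k).symm
    change l i = (block d i).embDomain ⟨Prod.mk i, Prod.mk_right_injective i⟩
    rw [← he i, hd, block_sum_embDomain]
  · intro h
    exact absurd (Finset.mem_finsuppAntidiag.2 ⟨sum_embDomain_block d, by simp⟩) h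

/-- The basis of products of monomial symmetric functions. -/
def multiMonomialBasis (r : ℕ) : Module.Basis (Fin r → YoungDiagram) ℚ (MultiSymmFun r) :=
  Basis.piTensorProduct fun _ => monomialBasis

/-- Both sides are linear in `f` and agree on products of monomial symmetric functions. Every tuple
of shapes occurs for some `d`, so the expansion determines all coordinates. -/
theorem coeff_expand (f : MultiSymmFun r) (d : Fin r × ℕ →₀ ℕ) :
    MvPowerSeries.coeff d (expand r f) =
      (multiMonomialBasis r).repr f fun i => shape (block d i) := by
  classical
  have h : (MvPowerSeries.coeff d).comp (expand r) =
      (Finsupp.lapply fun i => shape (block d i)).comp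
        (multiMonomialBasis r).repr.toLinearMap := by
    refine (multiMonomialBasis r).ext fun μ => ?_
    simp only [LinearMap.comp_apply, LinearEquiv.coe_coe, Module.Basis.repr_self,
      Finsupp.lapply_apply]
    rw [multiMonomialBasis, Basis.piTensorProduct_apply, coeff_expand_tprod]
    simp only [monomialBasis_apply, coeff_monomialSymm, Finsupp.single_apply,
      Fintype.prod_ite_zero, Finset.prod_const_one, funext_iff]
    congr 1
    simp only [eq_comm]
  exact DFunLike.congr_fun h f

/-- The exponent vector of the leading monomial of shape `μ`. -/
def multiRowExponent (μ : Fin r → YoungDiagram) : Fin r × ℕ →₀ ℕ :=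
  ∑ k, (rowExponent (μ k)).embDomain ⟨Prod.mk k, Prod.mk_right_injective k⟩

theorem shape_block_multiRowExponent (μ : Fin r → YoungDiagram) :
    (fun i => shape (block (multiRowExponent μ) i)) = μ := by
  funext i
  rw [multiRowExponent, block_sum_embDomain, shape_rowExponent]

theorem expand_injective (r : ℕ) : Function.Injective (expand r) := by
  intro f g h
  refine (multiMonomialBasis r).ext_elem fun μ => ?_
  rw [← shape_block_multiRowExponent μ, ← coeff_expand, ← coeff_expand, h]

theorem degree_multiRowExponent (μ : Fin r → YoungDiagram) :
    (multiRowExponent μ).degree = ∑ i, (μ i).card := by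
  rw [degree_eq_sum_block]
  refine Finset.sum_congr rfl fun i _ => ?_
  rw [← card_shape, congrFun (shape_block_multiRowExponent μ) i]

theorem finite_sum_card_eq (N : ℕ) : {μ : Fin r → YoungDiagram | ∑ i, (μ i).card = N}.Finite := by
  refine (Set.Finite.pi' fun _ : Fin r => finite_card_le N).subset fun μ hμ i => ?_
  have hμ : ∑ i, (μ i).card = N := hμ
  rw [Set.mem_ofPred_eq, ← hμ]
  exact Finset.single_le_sum (f := fun i => (μ i).card) (fun _ _ => Nat.zero_le _)
    (Finset.mem_univ i)

end Expansion

/-! ### Multi-symmetric Schur functions -/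

section Limit

variable {r : ℕ}

/-- A number of variables sufficient to compute a coefficient of a multi-symmetric Schur
function. -/
def stableBound (lam : Fin r → YoungDiagram) (d : Fin r × ℕ →₀ ℕ) : ℕ :=
  ∑ i, (lam i).colLen 0 + d.support.sup fun x => x.2 + 1

theorem colLen_le_stableBound (lam : Fin r → YoungDiagram) (d : Fin r × ℕ →₀ ℕ) (i : Fin r) :
    (lam i).colLen 0 ≤ stableBound lam d :=
  (Finset.single_le_sum (f := fun i => (lam i).colLen 0) (fun _ _ => Nat.zero_le _)
    (Finset.mem_univ i)).trans (Nat.le_add_right _ _)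

theorem lt_stableBound (lam : Fin r → YoungDiagram) {d : Fin r × ℕ →₀ ℕ} {i : Fin r} {j : ℕ}
    (h : d (i, j) ≠ 0) : j < stableBound lam d :=
  (Finset.le_sup (f := fun x : Fin r × ℕ => x.2 + 1) (Finsupp.mem_support_iff.2 h)).trans
    (Nat.le_add_left _ _)

/-- The coefficients of the multi-symmetric Schur functions. -/
def limitCoeff (lam : Fin r → YoungDiagram) (d : Fin r × ℕ →₀ ℕ) : ℚ :=
  (multiKey lam fun _ => List.range (stableBound lam d)).coeff d

theorem coeff_multiKey_eq_limitCoeff (lam : Fin r → YoungDiagram) (vs : Fin r → List ℕ)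
    (hv : ∀ i, (vs i).Nodup) (hl : ∀ i, (lam i).colLen 0 ≤ (vs i).length) {d : Fin r × ℕ →₀ ℕ}
    (hd : ∀ i j, d (i, j) ≠ 0 → j ∈ vs i) :
    (multiKey lam vs).coeff d = limitCoeff lam d := by
  classical
  -- Two choices of variables are compared through their union, to which stability applies from
  -- either side.
  let ws : Fin r → List ℕ := fun i => ((vs i).toFinset ∪ Finset.range (stableBound lam d)).toList
  have hw : ∀ i, (ws i).Nodup := fun i => Finset.nodup_toList _
  rw [← coeff_multiKey_of_subset lam vs ws (fun i j hj => by simp [ws, hj]) hv hw hl hd, limitCoeff,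
    ← coeff_multiKey_of_subset lam _ ws (fun i j hj => by
        simp only [ws, Finset.mem_toList, Finset.mem_union, Finset.mem_range]
        exact Or.inr (List.mem_range.1 hj)) (fun _ => List.nodup_range) hw
      (fun i => by simpa using colLen_le_stableBound lam d i)
      fun i j h => List.mem_range.2 (lt_stableBound lam h)]

theorem coeff_multiSchurPoly (lam : Fin r → YoungDiagram) {n : Fin r → ℕ} {d : Fin r × ℕ →₀ ℕ}
    (hl : ∀ i, (lam i).colLen 0 ≤ n i) (hd : ∀ i j, d (i, j) ≠ 0 → j < n i) :
    (multiSchurPoly lam n).coeff d = limitCoeff lam d := by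
  rw [multiSchurPoly_eq_multiKey]
  exact coeff_multiKey_eq_limitCoeff lam _ (fun i => List.nodup_range) (fun i => by simpa using hl i)
    fun i j h => List.mem_range.2 (hd i j h)

theorem coeff_multiSchurPoly_eq_zero (lam : Fin r → YoungDiagram) {n : Fin r → ℕ}
    {d : Fin r × ℕ →₀ ℕ} (hd : ¬ ∀ i j, d (i, j) ≠ 0 → j < n i) :
    (multiSchurPoly lam n).coeff d = 0 := by
  by_contra hne
  rw [multiSchurPoly_eq_multiKey] at hne
  exact hd fun i j h => List.mem_range.1 (mem_of_coeff_multiKey_ne_zero hne h)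

/-- Renaming by `s` only changes the list of variables used, of which the coefficients are
independent. -/
theorem limitCoeff_eq_of_perm (lam : Fin r → YoungDiagram) (s : Fin r → Equiv.Perm ℕ)
    {d d' : Fin r × ℕ →₀ ℕ} (h : ∀ i j, d' (i, s i j) = d (i, j)) :
    limitCoeff lam d' = limitCoeff lam d := by
  have hinj : Function.Injective fun x : Fin r × ℕ => (x.1, s x.1 x.2) := by
    rintro ⟨i, j⟩ ⟨i', j'⟩ hx
    simp only [Prod.mk.injEq] at hx
    obtain ⟨rfl, hx⟩ := hx
    rw [(s i).injective hx]
  have hd' : d' = d.mapDomain fun x : Fin r × ℕ => (x.1, s x.1 x.2) := by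
    ext ⟨i, j⟩
    obtain ⟨k, rfl⟩ := (s i).surjective j
    rw [h]
    exact (Finsupp.mapDomain_apply hinj d (i, k)).symm
  change _ = (multiKey lam fun _ => List.range (stableBound lam d)).coeff d
  rw [← coeff_rename_mapDomain _ hinj, ← hd', rename_multiKey]
  symm
  refine coeff_multiKey_eq_limitCoeff lam _ (fun i => List.nodup_range.map (s i).injective)
    (fun i => by simpa using colLen_le_stableBound lam d i) fun i j hj => ?_
  obtain ⟨k, rfl⟩ := (s i).surjective j
  rw [h] at hj
  exact List.mem_map_of_mem (List.mem_range.2 (lt_stableBound lam hj))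

/-- Since the coefficients depend only on the shapes of the blocks, the limit is a combination of
products of monomial symmetric functions. -/
theorem limitCoeff_multiRowExponent (lam : Fin r → YoungDiagram) (d : Fin r × ℕ →₀ ℕ) :
    limitCoeff lam (multiRowExponent fun i => shape (block d i)) = limitCoeff lam d := by
  have h : ∀ i, ∃ s : Equiv.Perm ℕ, ∀ j, rowExponent (shape (block d i)) (s j) = block d i j :=
    fun i => exists_perm_of_exponents_eq (exponents_rowExponent_shape (block d i)).symm
  choose s hs using h
  refine limitCoeff_eq_of_perm lam s fun i j => ?_
  rw [multiRowExponent, sum_embDomain_apply, hs, block_apply]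

/-- Homogeneity makes this combination finite, and later supplies the grading for the dimension
count. -/
theorem degree_of_limitCoeff_ne_zero {lam : Fin r → YoungDiagram} {d : Fin r × ℕ →₀ ℕ}
    (h : limitCoeff lam d ≠ 0) : d.degree = ∑ i, (lam i).card := by
  have hom := isHomogeneous_multiKey lam (fun _ => List.range (stableBound lam d))
    fun _ => List.nodup_range
  by_contra hne
  refine h (hom.coeff_eq_zero ?_)
  refine fun e => hne (e.trans (Finset.sum_congr rfl fun i _ => ?_))
  rw [List.length_range, sum_revParts (colLen_le_stableBound lam d i)]

/-- The multi-symmetric Schur function of an `r`-tuple of partitions. -/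
def multiSchurFun (lam : Fin r → YoungDiagram) : MultiSymmFun r :=
  (multiMonomialBasis r).repr.symm
    (Finsupp.onFinset (finite_sum_card_eq (∑ i, (lam i).card)).toFinset
      (fun μ => limitCoeff lam (multiRowExponent μ)) fun μ hμ => by
        rw [Set.Finite.mem_toFinset, Set.mem_ofPred_eq, ← degree_multiRowExponent]
        exact degree_of_limitCoeff_ne_zero hμ)

theorem repr_multiSchurFun (lam μ : Fin r → YoungDiagram) :
    (multiMonomialBasis r).repr (multiSchurFun lam) μ = limitCoeff lam (multiRowExponent μ) := by
  simp [multiSchurFun]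

theorem coeff_expand_multiSchurFun (lam : Fin r → YoungDiagram) (d : Fin r × ℕ →₀ ℕ) :
    MvPowerSeries.coeff d (expand r (multiSchurFun lam)) = limitCoeff lam d := by
  rw [coeff_expand, repr_multiSchurFun, limitCoeff_multiRowExponent]

theorem isMultiSchurFun_multiSchurFun (lam : Fin r → YoungDiagram) :
    IsMultiSchurFun lam (multiSchurFun lam) := by
  intro d
  filter_upwards [Filter.eventually_ge_atTop fun _ => stableBound lam d] with n hn
  rw [coeff_expand_multiSchurFun]
  exact coeff_multiSchurPoly lam (fun i => (colLen_le_stableBound lam d i).trans (hn i))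
    fun i j h => (lt_stableBound lam h).trans_le (hn i)

/-! ### Truncation to finitely many variables, linear independence and spanning -/

/-- The monomial with exponents `d` involves only variables `x_{i,j}` with `j < n i`. -/
def IsBoundedBy (n : Fin r → ℕ) (d : Fin r × ℕ →₀ ℕ) : Prop := ∀ i j, d (i, j) ≠ 0 → j < n i

open Classical in
/-- Setting the variables `x_{i,j}` with `j ≥ n i` to zero. -/
def truncate (n : Fin r → ℕ) :
    MvPowerSeries (Fin r × ℕ) ℚ →ₗ[ℚ] MvPowerSeries (Fin r × ℕ) ℚ :=
  LinearMap.pi fun d => if IsBoundedBy n d then MvPowerSeries.coeff d else 0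

open Classical in
theorem coeff_truncate (n : Fin r → ℕ) (f : MvPowerSeries (Fin r × ℕ) ℚ) (d : Fin r × ℕ →₀ ℕ) :
    MvPowerSeries.coeff d (truncate n f) =
      if IsBoundedBy n d then MvPowerSeries.coeff d f else 0 := by
  change (if IsBoundedBy n d then MvPowerSeries.coeff d else 0 :
    MvPowerSeries (Fin r × ℕ) ℚ →ₗ[ℚ] ℚ) f = _
  split_ifs <;> rfl

/-- Once `n i` is at least the number of parts, the coefficients of monomials in the retained
variables are already stable. -/
theorem truncate_expand_multiSchurFun (lam : Fin r → YoungDiagram) {n : Fin r → ℕ}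
    (hl : ∀ i, (lam i).colLen 0 ≤ n i) :
    truncate n (expand r (multiSchurFun lam)) = (multiSchurPoly lam n : MvPowerSeries _ ℚ) := by
  ext d
  rw [coeff_truncate, MvPolynomial.coeff_coe, coeff_expand_multiSchurFun]
  split_ifs with h
  · rw [coeff_multiSchurPoly lam hl h]
  · rw [coeff_multiSchurPoly_eq_zero lam h]

theorem blockComposition_finSigmaFinEquiv (lam : Fin r → YoungDiagram) (n : Fin r → ℕ)
    (x : (i : Fin r) × Fin (n i)) :
    blockComposition lam n (finSigmaFinEquiv x) = (lam x.1).rowLen x.2.rev :=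
  congrArg (fun y : (i : Fin r) × Fin (n i) => (lam y.1).rowLen y.2.rev)
    (finSigmaFinEquiv.symm_apply_apply x)

theorem blockComposition_injOn (n : Fin r → ℕ) :
    Set.InjOn (fun lam : Fin r → YoungDiagram => blockComposition lam n)
      {lam | ∀ i, (lam i).colLen 0 ≤ n i} := by
  intro lam hlam mu hmu h
  have hrow : ∀ i k, (lam i).rowLen k = (mu i).rowLen k := by
    intro i k
    rcases lt_or_ge k (n i) with hk | hk
    · have := congrFun h (finSigmaFinEquiv ⟨i, (⟨k, hk⟩ : Fin (n i)).rev⟩)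
      simpa only [blockComposition_finSigmaFinEquiv, Fin.rev_rev] using this
    · rw [rowLen_eq_zero ((hlam i).trans hk), rowLen_eq_zero ((hmu i).trans hk)]
  funext i
  ext ⟨a, b⟩
  simp [YoungDiagram.mem_iff_lt_rowLen, hrow]

theorem linearIndependent_multiSchurFun (r : ℕ) :
    LinearIndependent ℚ (multiSchurFun : (Fin r → YoungDiagram) → MultiSymmFun r) := by
  rw [linearIndependent_iff_finset_linearIndependent]
  intro S
  -- With `n i` the maximal number of parts in the finite family, no part is lost: the truncations
  -- are key polynomials of distinct compositions.
  let n : Fin r → ℕ := fun i => S.sup fun lam => (lam i).colLen 0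
  have hn : ∀ lam : S, ∀ i, (lam.1 i).colLen 0 ≤ n i := fun lam i =>
    Finset.le_sup (f := fun lam : Fin r → YoungDiagram => (lam i).colLen 0) lam.2
  refine LinearIndependent.of_comp ((truncate n).comp (expand r)) ?_
  have hkey := (linearIndependent_keyPoly (∑ i, n i)).comp
    (fun lam : S => blockComposition lam.1 n) fun a b h =>
      Subtype.ext (blockComposition_injOn n (hn a) (hn b) h)
  have hv : Function.Injective fun k : Fin (∑ i, n i) =>
      ((finSigmaFinEquiv.symm k).1, ((finSigmaFinEquiv.symm k).2 : ℕ)) := by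
    intro a b hab
    apply finSigmaFinEquiv.symm.injective
    simp only [Prod.mk.injEq] at hab
    exact Sigma.ext hab.1 ((Fin.heq_ext_iff (by rw [hab.1])).2 hab.2)
  have h₁ := hkey.map' (rename fun k : Fin (∑ i, n i) =>
    ((finSigmaFinEquiv.symm k).1, ((finSigmaFinEquiv.symm k).2 : ℕ))).toLinearMap
      (LinearMap.ker_eq_bot.2 (rename_injective _ hv))
  have h₂ := h₁.map' (MvPolynomial.coeToMvPowerSeries.algHom ℚ (R := ℚ)).toLinearMap
    (LinearMap.ker_eq_bot.2 (by
      intro f g hfg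
      simpa using hfg))
  have heq : ((truncate n).comp (expand r) : MultiSymmFun r → _) ∘
      (fun lam : S => multiSchurFun lam.1) = fun lam : S =>
        (multiSchurPoly lam.1 n : MvPowerSeries (Fin r × ℕ) ℚ) :=
    funext fun lam => truncate_expand_multiSchurFun _ (hn lam)
  exact heq ▸ h₂

end Limit

/-- A linearly independent family that is homogeneous with respect to a grading of a basis with
finite parts is spanning. -/
theorem span_range_eq_top_of_graded {K M I : Type*} [Field K] [AddCommMonoid M] [Module K M]
    (b : Module.Basis I K M) (w : I → ℕ) (hw : ∀ N, {i | w i = N}.Finite) (s : I → M)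
    (hli : LinearIndependent K s) (hs : ∀ i j, b.repr (s i) j ≠ 0 → w j = w i) :
    Submodule.span K (Set.range s) = ⊤ := by
  -- Dimension theory needs additive inverses, which scalar multiplication by `-1` provides.
  let _ : AddCommGroup M := Module.addCommMonoidToAddCommGroup K
  rw [eq_top_iff, ← b.span_eq, Submodule.span_le]
  rintro _ ⟨i, rfl⟩
  let S : Set I := {j | w j = w i}
  have : Fintype S := (hw (w i)).fintype
  have hb := finrank_span_eq_card (b.linearIndependent.comp (Subtype.val : S → I)
    Subtype.val_injective)
  have hc := finrank_span_eq_card (hli.comp (Subtype.val : S → I) Subtype.val_injective)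
  have hle : Submodule.span K (Set.range (s ∘ (Subtype.val : S → I))) ≤
      Submodule.span K (Set.range (b ∘ (Subtype.val : S → I))) := by
    rw [Submodule.span_le]
    rintro _ ⟨j, rfl⟩
    rw [Set.range_comp, Subtype.range_coe, SetLike.mem_coe, Module.Basis.mem_span_image]
    intro k hk
    exact (hs j k (Finsupp.mem_support_iff.1 hk)).trans j.2
  have : FiniteDimensional K (Submodule.span K (Set.range (b ∘ (Subtype.val : S → I)))) :=
    FiniteDimensional.span_of_finite K (Set.finite_range _)
  -- Both spans have dimension the cardinality of `S`, so the inclusion is an equality and contains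
  -- `b i`.
  have heq := Submodule.eq_of_le_of_finrank_eq hle (hc.trans hb.symm)
  have hi : b i ∈ Submodule.span K (Set.range (b ∘ (Subtype.val : S → I))) :=
    Submodule.subset_span ⟨⟨i, rfl⟩, rfl⟩
  rw [← heq] at hi
  exact Submodule.span_mono (Set.range_comp_subset_range _ _) hi

theorem span_multiSchurFun (r : ℕ) :
    Submodule.span ℚ (Set.range (multiSchurFun : (Fin r → YoungDiagram) → MultiSymmFun r)) = ⊤ := by
  have hs : ∀ lam μ : Fin r → YoungDiagram, (multiMonomialBasis r).repr (multiSchurFun lam) μ ≠ 0 →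
      ∑ i, (μ i).card = ∑ i, (lam i).card := by
    intro lam μ h
    rw [repr_multiSchurFun] at h
    rw [← degree_multiRowExponent, degree_of_limitCoeff_ne_zero h]
  exact span_range_eq_top_of_graded (multiMonomialBasis r) (fun μ => ∑ i, (μ i).card)
    finite_sum_card_eq _ (linearIndependent_multiSchurFun r) hs

/-- The basis of multi-symmetric Schur functions. -/
def multiSchurBasis (r : ℕ) : Module.Basis (Fin r → YoungDiagram) ℚ (MultiSymmFun r) :=
  Module.Basis.mk (linearIndependent_multiSchurFun r) (span_multiSchurFun r).ge

theorem multiSchurBasis_apply {r : ℕ} (lam : Fin r → YoungDiagram) :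
    multiSchurBasis r lam = multiSchurFun lam := by
  simp [multiSchurBasis]

end MultiSymm

end

/-- Multi-symmetric functions are determined by their power series expansions, so that there is at
most one multi-symmetric Schur function for each `r`-tuple of partitions; these functions exist in
`Λ(X_1|⋯|X_r)` and form a basis of it, indexed by the `r`-tuples of partitions. -/
theorem mainTheorem11 (r : ℕ) :
    Function.Injective (MultiSymm.expand r) ∧
    ∃ b : Module.Basis (Fin r → YoungDiagram) ℚ (MultiSymm.MultiSymmFun r),
      ∀ lam : Fin r → YoungDiagram, MultiSymm.IsMultiSchurFun lam (b lam) :=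
  ⟨MultiSymm.expand_injective r, MultiSymm.multiSchurBasis r, fun lam => by
    rw [MultiSymm.multiSchurBasis_apply]
    exact MultiSymm.isMultiSchurFun_multiSchurFun lam⟩
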